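/- Let $C=(C_{ij})_{0\le i,j\le n}$ be an indecomposable Cartan matrix of non-twisted affine type, $I=\{1,\dots,n\}$, let $d_i$ be the relatively prime positive integers such that $(d_iC_{ij})$ is symmetric, let $q\in\mathbb C^\times$ not be a root of unity, and put $q_i=q^{d_i}$. Let $U_q(\mathfrak g)$ be the quantum loop algebra, with its Drinfeld generators $x^\pm_{i,r}$ ($r\in\mathbb Z$), $\phi^\pm_{i,\pm m}$ ($m\ge 0$), $k_i^{\pm1}$ ($i\in I$), and let $U_q(\mathfrak b)\subset U_q(\mathfrak g)$ be the Borel algebra, i.e. the subalgebra generated by $k_i^{\pm1}$, $e_i=x^+_{i,0}$ ($i\in I$) and $$e_0=[\tilde x^-_{i_1,0},[\tilde x^-_{i_2,0},\cdots,[\tilde x^-_{i_k,0},\tilde x^-_{j_0,1}]_q\cdots]_q]_q,\qquad \tilde x^-_{i,r}=k_i^{-1}x^-_{i,r},$$ where $[A,B]_q=AB-q^{(\alpha,\beta)}BA$ for $A,B$ of weights $\alpha,\beta$, and where $i_1,\dots,i_k,j_0\in I$ are such that the commutator $[\dot x^+_{i_1},[\dot x^+_{i_2},\cdots,[\dot x^+_{i_k},\dot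 x^+_{j_0}]\cdots]]$ of simple root vectors is a non-zero maximal root vector of the simple Lie algebra with Cartan matrix $(C_{ij})_{i,j\in I}$. Put $\mathfrak t^*=(\mathbb C^\times)^I$, $\overline\alpha_i=(q_i^{C_{ij}})_{j\in I}\in\mathfrak t^*$, and write $\omega\le\omega'$ if $\omega\omega'^{-1}$ is a product of elements $\overline\alpha_i^{-1}$. For a $U_q(\mathfrak b)$-module $V$ and $\omega\in\mathfrak t^*$ let $V_\omega=\{v\in V: k_iv=\omega(i)v\ \forall i\in I\}$. The module $V$ is in category $\mathcal O$ if $V=\bigoplus_\omega V_\omega$, all $V_\omega$ are finite-dimensional, and there are finitely many $\lambda_1,\dots,\lambda_s\in\mathfrak t^*$ such that every $\omega$ with $V_\omega\ne0$ satisfies $\omega\le\lambda_j$ for some $j$. An $\ell$-weight is a family $\Psi=(\Psi_i(z))_{i\in I}$ of power series $\Psi_i(z)=\sum_{m\ge0}\Psi_{i,m}z^m\in\mathbb C[[z]]$ with $\Psi_{i,0}\neq0$; its $\ell$-weight space is $$V_\Psi=\{v\in V:\ \exists p\ge0\ \forall i\in I\ \forall m\ge0,\ (\phi^+_{i,m}-\Psi_{i,m})^pv=0\}.$$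 Let $V$ be a $U_q(\mathfrak b)$-module and let $\Psi$ be an $\ell$-weight with $V_\Psi\ne0$. (1) Let $i\in I$ and let $\omega=(\Psi_{j,0})_{j\in I}$. If $V_\omega$, $V_{\omega\overline\alpha_i}$ and $V_{\omega\overline\alpha_i^{-1}}$ are finite-dimensional, then $\Psi_i(z)$ is rational, i.e. the expansion at $0$ of a rational function. (2) If $V$ is in category $\mathcal O$, then $\Psi_i(z)$ is rational for every $i\in I$. -/

import Mathlib

open scoped BigOperators

namespace QuantumLoop

noncomputable section

/-! ### `q`-integers -/

/-- The `q`-integer `[m]_z = (z ^ m - z ^ (-m)) / (z - z⁻¹)`. -/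
def qInt (z : ℂ) (m : ℕ) : ℂ := (z ^ m - (z⁻¹) ^ m) / (z - z⁻¹)

/-- The `q`-factorial `[m]_z! = [1]_z [2]_z ⋯ [m]_z`. -/
def qFactorial (z : ℂ) (m : ℕ) : ℂ := ∏ j ∈ Finset.range m, qInt z (j + 1)

/-- The `q`-binomial coefficient (used for `r ≤ s` only). -/
def qBinom (z : ℂ) (s r : ℕ) : ℂ :=
  qFactorial z s / (qFactorial z r * qFactorial z (s - r))

/-! ### The quantum loop algebra in its Drinfeld realization -/

/-- The generators of the quantum loop algebra; signs `±` are units `ε : ℤˣ`.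
* `x ε i r` is `x̃^ε_{i,r}`;
* `phiP i m` is `φ̃⁺_{i,m}` and `phiM i m` is `φ̃⁻_{i,-m}`, for `m ≥ 0`;
* `kap i` is `κ_i` and `kapInv i` is its inverse. -/
inductive Gen (I : Type*) : Type _
  | x (ε : ℤˣ) (i : I) (r : ℤ) : Gen I
  | phiP (i : I) (m : ℕ) : Gen I
  | phiM (i : I) (m : ℕ) : Gen I
  | kap (i : I) : Gen I
  | kapInv (i : I) : Gen I

section Free

variable {I : Type*}

/-- The free generator `x̃^ε_{i,r}`. -/
def fx (ε : ℤˣ) (i : I) (r : ℤ) : FreeAlgebra ℂ (Gen I) := FreeAlgebra.ι ℂ (Gen.x ε i r)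

/-- The free generator `φ̃⁺_{i,m}`. -/
def fphiP (i : I) (m : ℕ) : FreeAlgebra ℂ (Gen I) := FreeAlgebra.ι ℂ (Gen.phiP i m)

/-- The free generator `φ̃⁻_{i,-m}`. -/
def fphiM (i : I) (m : ℕ) : FreeAlgebra ℂ (Gen I) := FreeAlgebra.ι ℂ (Gen.phiM i m)

/-- The free generator `κ_i`. -/
def fkap (i : I) : FreeAlgebra ℂ (Gen I) := FreeAlgebra.ι ℂ (Gen.kap i)

/-- The free generator `κ_i⁻¹`. -/
def fkapInv (i : I) : FreeAlgebra ℂ (Gen I) := FreeAlgebra.ι ℂ (Gen.kapInv i)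

/-- `φ̃⁺_{i,n}` for every integer `n`; it is `0` for `n < 0`. -/
def fphiPZ (i : I) (n : ℤ) : FreeAlgebra ℂ (Gen I) := if 0 ≤ n then fphiP i n.toNat else 0

/-- `φ̃⁻_{i,n}` for every integer `n`; it is `0` for `n > 0`. -/
def fphiMZ (i : I) (n : ℤ) : FreeAlgebra ℂ (Gen I) := if n ≤ 0 then fphiM i (-n).toNat else 0

/-- The left hand side of the Drinfeld-Serre relation for `i ≠ j`, with `s = 1 - C_{ij}`:
the sum over `π ∈ Σ_s` and `0 ≤ k ≤ s` of
`(-1)^k [s choose k]_z x_{i,r_{π(1)}} ⋯ x_{i,r_{π(k)}} x_{j,r'} x_{i,r_{π(k+1)}} ⋯ x_{i,r_{π(s)}}`. -/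
def serreSum (z : ℂ) (ε : ℤˣ) (i j : I) (s : ℕ) (r : Fin s → ℤ) (r' : ℤ) :
    FreeAlgebra ℂ (Gen I) :=
  ∑ π : Equiv.Perm (Fin s), ∑ k ∈ Finset.range (s + 1),
    ((-1) ^ k * qBinom z s k) •
      (((List.ofFn fun t => fx ε i (r (π t))).take k).prod * fx ε j r' *
        ((List.ofFn fun t => fx ε i (r (π t))).drop k).prod)

end Free

variable {I : Type*} (C : Matrix I I ℤ) (d : I → ℕ) (q : ℂ)

/-- `q_i ^ (n C_{ij})`, where `q_i = q ^ d_i`. -/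
def qpow (i j : I) (n : ℤ) : ℂ := (q ^ d i) ^ (n * C i j)

/-- The defining relations of the quantum loop algebra in terms of the generators
`x̃^±_{i,r}`, `φ̃^±_{i,±m}`, `κ_i^{±1}`. -/
inductive Rel : FreeAlgebra ℂ (Gen I) → FreeAlgebra ℂ (Gen I) → Prop
  | kap_mul_inv (i : I) : Rel (fkap i * fkapInv i) 1
  | inv_mul_kap (i : I) : Rel (fkapInv i * fkap i) 1
  | kap_comm (i j : I) : Rel (fkap i * fkap j) (fkap j * fkap i)
  | kap_phiP (i j : I) (m : ℕ) : Rel (fkap i * fphiP j m) (fphiP j m * fkap i)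
  | kap_phiM (i j : I) (m : ℕ) : Rel (fkap i * fphiM j m) (fphiM j m * fkap i)
  | phiP_zero (i : I) : Rel (fphiP i 0) 1
  | phiM_zero (i : I) : Rel (fphiM i 0) (fkap i ^ 2)
  | phiP_phiP (i j : I) (m m' : ℕ) : Rel (fphiP i m * fphiP j m') (fphiP j m' * fphiP i m)
  | phiM_phiM (i j : I) (m m' : ℕ) : Rel (fphiM i m * fphiM j m') (fphiM j m' * fphiM i m)
  | phiP_phiM (i j : I) (m m' : ℕ) : Rel (fphiP i m * fphiM j m') (fphiM j m' * fphiP i m)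
  | kap_x (ε : ℤˣ) (i j : I) (r : ℤ) :
      Rel (fkap i * fx ε j r) (qpow C d q i j (-ε) • (fx ε j r * fkap i))
  | phiP_x (ε : ℤˣ) (i j : I) (m : ℕ) (r : ℤ) :
      Rel (fphiP i m * fx ε j r)
        (∑ l ∈ Finset.range (m + 1),
            qpow C d q i j (ε * l) • (fx ε j (r + l) * fphiP i (m - l)) -
          ∑ l ∈ Finset.range m,
            qpow C d q i j (ε * ((l : ℤ) - 1)) • (fx ε j (r + l + 1) * fphiP i (m - l - 1)))
  | phiM_x (ε : ℤˣ) (i j : I) (m : ℕ) (r : ℤ) :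
      Rel (fphiM i m * fx ε j r)
        (-(∑ l ∈ Finset.range m,
            qpow C d q i j (-ε * ((l : ℤ) + 1)) • (fx ε j (r - l - 1) * fphiM i (m - l - 1))) +
          ∑ l ∈ Finset.range (m + 1),
            qpow C d q i j (-ε * ((l : ℤ) + 2)) • (fx ε j (r - l) * fphiM i (m - l)))
  | xP_xM_same (i : I) (r r' : ℤ) :
      Rel (qpow C d q i i (-1) • (fx 1 i r * fx (-1) i r') - fx (-1) i r' * fx 1 i r)
        ((q ^ d i - (q ^ d i)⁻¹)⁻¹ • (fphiPZ i (r + r') - fphiMZ i (r + r')))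
  | xP_xM_ne (i j : I) (r r' : ℤ) (hij : i ≠ j) :
      Rel (qpow C d q i j (-1) • (fx 1 i r * fx (-1) j r') - fx (-1) j r' * fx 1 i r) 0
  | x_x (ε : ℤˣ) (i j : I) (r r' : ℤ) :
      Rel (fx ε i (r + 1) * fx ε j r' - qpow C d q i j ε • (fx ε j r' * fx ε i (r + 1)))
        (qpow C d q i j ε • (fx ε i r * fx ε j (r' + 1)) - fx ε j (r' + 1) * fx ε i r)
  | serre (ε : ℤˣ) (i j : I) (hij : i ≠ j) (r : Fin (1 - C i j).toNat → ℤ) (r' : ℤ) :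
      Rel (serreSum (q ^ d i) ε i j (1 - C i j).toNat r r') 0

/-- The quantum loop algebra `U_q(𝔤)` in its Drinfeld realization, for the untwisted affine
algebra `𝔤` whose underlying finite Cartan matrix is `C = (C_{ij})_{i,j ∈ I}`, with symmetrizing
integers `d`. -/
def LoopAlgebra : Type _ := RingQuot (Rel C d q)

instance : Ring (LoopAlgebra C d q) := inferInstanceAs (Ring (RingQuot (Rel C d q)))

instance : Algebra ℂ (LoopAlgebra C d q) := inferInstanceAs (Algebra ℂ (RingQuot (Rel C d q)))

/-- The quotient map from the free algebra. -/
def LoopAlgebra.mk : FreeAlgebra ℂ (Gen I) →ₐ[ℂ] LoopAlgebra C d q := RingQuot.mkAlgHom ℂ (Rel C d q)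

/-- The element `x̃⁺_{i,r} = x⁺_{i,r}`. -/
def xPlus (i : I) (r : ℤ) : LoopAlgebra C d q := LoopAlgebra.mk C d q (fx 1 i r)

/-- The element `x̃⁻_{i,r} = κ_i x⁻_{i,r}`. -/
def xTildeMinus (i : I) (r : ℤ) : LoopAlgebra C d q := LoopAlgebra.mk C d q (fx (-1) i r)

/-- The element `k_i = κ_i⁻¹`. -/
def k (i : I) : LoopAlgebra C d q := LoopAlgebra.mk C d q (fkapInv i)

/-- The element `k_i⁻¹ = κ_i`. -/
def kInv (i : I) : LoopAlgebra C d q := LoopAlgebra.mk C d q (fkap i)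

/-- The Drinfeld generator `φ⁺_{i,m} = κ_i⁻¹ φ̃⁺_{i,m}`. -/
def phiPlus (i : I) (m : ℕ) : LoopAlgebra C d q :=
  LoopAlgebra.mk C d q (fkapInv i * fphiP i m)

/-- The iterated `q`-commutator
`[x̃⁻_{i₁,0}, [x̃⁻_{i₂,0}, ⋯, [x̃⁻_{i_k,0}, x̃⁻_{j₀,1}]_q ⋯ ]_q]_q` attached to the list
`i₁, …, i_k` and to `j₀`. Here `[A, B]_q = A B - q^{(α, β)} B A` for `A` of weight `α` and `B` of
weight `β`, and `(α_i, α_s) = d_i C_{is}`; the two weights are `-α_{i₁}` and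
`-(α_{i₂} + ⋯ + α_{i_k} + α_{j₀})`. -/
def iteratedBracket : List I → I → LoopAlgebra C d q
  | [], j₀ => xTildeMinus C d q j₀ 1
  | i :: l, j₀ =>
      xTildeMinus C d q i 0 * iteratedBracket l j₀ -
        q ^ ((l ++ [j₀]).map fun s => (d i : ℤ) * C i s).sum •
          (iteratedBracket l j₀ * xTildeMinus C d q i 0)

/-- The Borel algebra `U_q(𝔟)`: the subalgebra generated by the Chevalley generators
`e_i = x⁺_{i,0}` and `k_i^{±1}`, `i ∈ I`, and by `e_0`, the iterated `q`-commutator attached to an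
expression of the maximal root vector (see `IsMaximalRootWord`). The remaining generators
`k_0^{±1}` are products of the `k_i^{±1}`, `i ∈ I`. -/
def borel (l : List I) (j₀ : I) : Subalgebra ℂ (LoopAlgebra C d q) :=
  Algebra.adjoin ℂ
    (Set.range (fun i => xPlus C d q i 0) ∪ Set.range (k C d q) ∪ Set.range (kInv C d q) ∪
      {iteratedBracket C d q l j₀})

/-! ### Weights -/

/-- The weight `ᾱ_i ∈ 𝔱^* = (ℂˣ)^I` of the simple root `α_i`: `ᾱ_i(j) = q_i ^ C_{ij}`. -/
def simpleWeight (q : ℂˣ) (i : I) : I → ℂˣ := fun j => (q ^ d i) ^ C i j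

/-- The partial order on `𝔱^*`: `ω ≤ ω'` if `ω ω'⁻¹` is a product of elements `ᾱ_i⁻¹`. -/
def WeightLE [Fintype I] (q : ℂˣ) (ω ω' : I → ℂˣ) : Prop :=
  ∃ n : I → ℕ, ω * ω'⁻¹ = ∏ i, ((simpleWeight C d q i)⁻¹) ^ n i

end

noncomputable section

variable {I : Type*} (C : Matrix I I ℤ) (d : I → ℕ) (q : ℂˣ) (l : List I) (j₀ : I)

/-- `k_i` as an element of the Borel algebra. -/
def kBorel (i : I) : borel C d (q : ℂ) l j₀ :=
  ⟨k C d q i, Algebra.subset_adjoin (Or.inl (Or.inl (Or.inr ⟨i, rfl⟩)))⟩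

variable (V : Type*) [AddCommGroup V] [Module ℂ V] [Module (borel C d (q : ℂ) l j₀) V]
  [IsScalarTower ℂ (borel C d (q : ℂ) l j₀) V]

/-- The weight space `V_ω = {v | k_i v = ω(i) v for all i ∈ I}`. -/
def weightSpace (ω : I → ℂˣ) : Submodule ℂ V where
  carrier := {v | ∀ i, kBorel C d q l j₀ i • v = (ω i : ℂ) • v}
  zero_mem' := by simp
  add_mem' := by
    intro v w hv hw i
    rw [smul_add, smul_add, hv i, hw i]
  smul_mem' := by
    intro c v hv i
    have := smul_algebra_smul_comm c (kBorel C d q l j₀ i) v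
    rw [this, hv i, smul_comm]

/-- Category `𝒪` for `U_q(𝔟)`. -/
structure InCategoryO [Fintype I] : Prop where
  /-- The weight spaces are independent. -/
  independent : iSupIndep (weightSpace C d q l j₀ V)
  /-- The weight spaces span `V`. -/
  span : ⨆ ω, weightSpace C d q l j₀ V ω = ⊤
  /-- The weight spaces are finite dimensional. -/
  finite (ω : I → ℂˣ) : FiniteDimensional ℂ (weightSpace C d q l j₀ V ω)
  /-- The weights lie in a finite union of cones `D(λ) = {ω | ω ≤ λ}`. -/
  bounded : ∃ S : Finset (I → ℂˣ), ∀ ω, weightSpace C d q l j₀ V ω ≠ ⊥ →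
    ∃ μ ∈ S, WeightLE C d q ω μ

/-- The `ℓ`-weight space
`V_Ψ = {v | ∃ p, ∀ i m, (φ⁺_{i,m} - Ψ_{i,m})^p v = 0}`. The Drinfeld generator `φ⁺_{i,m}` acts on
`V` as the element `b` of `U_q(𝔟)` whose image in `U_q(𝔤)` is `φ⁺_{i,m}`. -/
def lWeightSpace (Ψ : I → PowerSeries ℂ) : Submodule ℂ V where
  carrier := {v | ∃ p : ℕ, ∀ (i : I) (m : ℕ) (b : borel C d (q : ℂ) l j₀),
    (b : LoopAlgebra C d (q : ℂ)) = phiPlus C d q i m →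
      (b - algebraMap ℂ _ (PowerSeries.coeff m (Ψ i))) ^ p • v = 0}
  zero_mem' := ⟨0, by simp⟩
  add_mem' := by
    rintro v w ⟨p, hp⟩ ⟨p', hp'⟩
    refine ⟨p + p', fun i m b hb => ?_⟩
    have h1 := hp i m b hb
    have h2 := hp' i m b hb
    rw [smul_add, add_comm p p', pow_add, mul_smul, h1, ← pow_add, add_comm p' p, pow_add,
      mul_smul, h2]
    simp
  smul_mem' := by
    rintro c v ⟨p, hp⟩
    refine ⟨p, fun i m b hb => ?_⟩
    rw [smul_algebra_smul_comm, hp i m b hb, smul_zero]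

end

/-- A formal power series over `ℂ` is (the expansion at `0` of) a rational function. -/
def IsRational (f : PowerSeries ℂ) : Prop :=
  ∃ P Q : Polynomial ℂ, Q ≠ 0 ∧ (Q : PowerSeries ℂ) * f = (P : PowerSeries ℂ)

/-- An `ℓ`-weight: a family of power series with non-zero constant terms. -/
def IsLWeight {I : Type*} (Ψ : I → PowerSeries ℂ) : Prop :=
  ∀ i, PowerSeries.constantCoeff (Ψ i) ≠ 0

/-- The integers `d_i` are positive, relatively prime, and `(d_i C_{ij})` is symmetric. -/
structure IsSymmetrizer {I : Type*} (C : Matrix I I ℤ) (d : I → ℕ) : Prop where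
  pos (i : I) : 0 < d i
  symm (i j : I) : (d i : ℤ) * C i j = d j * C j i
  coprime (n : ℕ) (hn : ∀ i, n ∣ d i) : n = 1

section RootSystem

variable {ι M N : Type*} [AddCommGroup M] [Module ℂ M] [AddCommGroup N] [Module ℂ N]
  {P : RootPairing ι ℂ M N}

/-- The sum of simple roots `α_{i₁} + ⋯ + α_{i_k} + α_{j₀}`. -/
def wordRoot (b : P.Base) (l : List b.support) (j₀ : b.support) : M :=
  (l.map fun i => P.root i).sum + P.root j₀

/-- The commutator `[ẋ⁺_{i₁}, [ẋ⁺_{i₂}, ⋯, [ẋ⁺_{i_k}, ẋ⁺_{j₀}] ⋯ ]]` of simple root vectors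
of the simple Lie algebra is a non-zero multiple of the maximal root vector: as
`[𝔤_α, 𝔤_β] = 𝔤_{α + β}` for roots `α`, `β` with `α + β ≠ 0` (where `𝔤_γ = 0` if `γ` is not a
root), this means that all the partial sums are roots and that the total sum is the highest
root. -/
structure IsMaximalRootWord (b : P.Base) (l : List b.support) (j₀ : b.support) : Prop where
  isRoot (l' : List b.support) (hl' : l' <:+ l) : wordRoot b l' j₀ ∈ Set.range P.root
  highest (a : ι) : wordRoot b l j₀ - P.root a ∈ AddSubmonoid.closure (P.root '' b.support)

end RootSystem

end QuantumLoop

/-! Up to a non-zero scalar, `φ⁺_{i,s+r+1}` is `k_i` times a `q`-commutator of `x⁺_{i,s}` and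
`x̃⁻_{i,r+1}`. If the weight spaces at `ω` and `ω ᾱ_i^{±1}` are finite-dimensional, then the maps
`V_{ω ᾱ_i} ⊕ V_ω → V_ω ⊕ V_{ω ᾱ_i⁻¹}` given by the `x̃⁻_{i,r+1}`, `r ≥ 0`, satisfy a non-trivial
linear relation with coefficients `c_r`, whence `∑ c_r φ⁺_{i,s+r+1} = 0` on `V_ω` for all `s ≥ 0`.
On a joint eigenvector this is a linear recurrence for the coefficients of `Ψ_i`.

These operators act on `V` only if they lie in the Borel algebra, where just `e_0` and the
`x⁺_{i,0}` are given. The iterated `q`-brackets of the `x̃⁻_{i,0}` and one `x̃⁻_{j,1}` span lines in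
positive root directions and vanish elsewhere, and `q`-commutators with the `x⁺_{i,0}` descend from
`e_0`, in the direction of the highest root, to every simple root, that is, to every `x̃⁻_{i,1}`.
From these, `q`-commutators generate the remaining elements. -/

namespace QuantumLoop

noncomputable section

section Generic

variable {K : Type*} [Field K]

/-- A generic value of the quantum parameter: non-zero and not a root of unity. -/
structure IsGeneric (z : K) : Prop where
  ne_zero : z ≠ 0
  pow_ne_one (n : ℕ) (hn : 0 < n) : z ^ n ≠ 1

namespace IsGeneric

variable {z : K} (hz : IsGeneric z)
include hz

lemma inv : IsGeneric z⁻¹ where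
  ne_zero := inv_ne_zero hz.ne_zero
  pow_ne_one n hn := by
    rw [inv_pow, ne_eq, inv_eq_one]
    exact hz.pow_ne_one n hn

lemma pow {n : ℕ} (hn : 0 < n) : IsGeneric (z ^ n) where
  ne_zero := pow_ne_zero _ hz.ne_zero
  pow_ne_one m hm := by
    rw [← pow_mul]
    exact hz.pow_ne_one _ (Nat.mul_pos hn hm)

lemma zpow_ne_one {n : ℤ} (hn : n ≠ 0) : z ^ n ≠ 1 := by
  obtain ⟨m, rfl | rfl⟩ := n.eq_nat_or_neg
  · rw [zpow_natCast]
    exact hz.pow_ne_one m (by omega)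
  · rw [zpow_neg, zpow_natCast, ne_eq, inv_eq_one]
    exact hz.pow_ne_one m (by omega)

lemma one_sub_zpow_ne_zero {n : ℤ} (hn : n ≠ 0) : 1 - z ^ n ≠ 0 :=
  sub_ne_zero.mpr (hz.zpow_ne_one hn).symm

lemma zpow_sub_zpow_ne_zero {m n : ℤ} (hmn : m ≠ n) : z ^ m - z ^ n ≠ 0 := by
  rw [← sub_add_cancel n m, zpow_add₀ hz.ne_zero, ← one_sub_mul]
  exact mul_ne_zero (hz.one_sub_zpow_ne_zero (sub_ne_zero.mpr hmn.symm))
    (zpow_ne_zero _ hz.ne_zero)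

lemma sub_inv_ne_zero : z - z⁻¹ ≠ 0 := by
  simpa using hz.zpow_sub_zpow_ne_zero (m := 1) (n := -1) (by decide)

end IsGeneric

end Generic

section QBinomial

lemma IsGeneric.qInt_ne_zero {z : ℂ} (hz : IsGeneric z) {m : ℕ} (hm : 0 < m) : qInt z m ≠ 0 := by
  refine div_ne_zero ?_ hz.sub_inv_ne_zero
  simpa using hz.zpow_sub_zpow_ne_zero (m := m) (n := -m) (by omega)

lemma IsGeneric.qFactorial_ne_zero {z : ℂ} (hz : IsGeneric z) (m : ℕ) : qFactorial z m ≠ 0 :=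
  Finset.prod_ne_zero_iff.mpr fun j _ => hz.qInt_ne_zero j.succ_pos

lemma qFactorial_succ (z : ℂ) (m : ℕ) :
    qFactorial z (m + 1) = qFactorial z m * qInt z (m + 1) :=
  Finset.prod_range_succ _ _

lemma qInt_zero (z : ℂ) : qInt z 0 = 0 := by
  simp [qInt]

lemma qInt_add (z : ℂ) (i j : ℕ) : qInt z (i + j) = z⁻¹ ^ j * qInt z i + z ^ i * qInt z j := by
  simp only [qInt, pow_add]
  ring

variable {A : Type*} [Ring A] [Algebra ℂ A]

/-- The coefficient of `a ^ i * b ^ j` in the `q`-binomial formula for `(a + b) ^ (i + j)`, without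
the factor `[i + j]_z!`. -/
def qBinomTerm (z : ℂ) (i j : ℕ) : ℂ := z ^ (i * j) / (qFactorial z i * qFactorial z j)

lemma qInt_mul_qBinomTerm {z : ℂ} (hz : IsGeneric z) (i j : ℕ) :
    qInt z (i + 1) * qBinomTerm z (i + 1) j = z ^ j * qBinomTerm z i j := by
  have h1 := hz.qInt_ne_zero i.succ_pos
  have h2 := hz.qFactorial_ne_zero i
  have h3 := hz.qFactorial_ne_zero j
  rw [qBinomTerm, qBinomTerm, qFactorial_succ, add_one_mul, pow_add]
  field_simp

lemma qBinomTerm_comm (z : ℂ) (i j : ℕ) : qBinomTerm z i j = qBinomTerm z j i := by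
  rw [qBinomTerm, qBinomTerm, mul_comm i, mul_comm (qFactorial z i)]

lemma mul_pow_of_mul_eq_smul {a b : A} {c : ℂ} (hab : b * a = c • (a * b)) (n : ℕ) :
    b * a ^ n = c ^ n • (a ^ n * b) := by
  induction n with
  | zero => simp
  | succ n ih =>
    rw [pow_succ, ← mul_assoc, ih, smul_mul_assoc, mul_assoc, hab, mul_smul_comm, smul_smul,
      ← pow_succ, mul_assoc]

open Finset in
/-- Multiplying the `n`-th formula by `a + b`, the term `a ^ i * b ^ j` of degree `n + 1` comes
from `(i - 1, j)` and `(i, j - 1)` with weights adding up to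
`[i + j] = z ^ (-j) [i] + z ^ i [j]`. -/
theorem add_pow_eq_sum_qBinomTerm {z : ℂ} (hz : IsGeneric z) {a b : A}
    (hab : b * a = z ^ 2 • (a * b)) (n : ℕ) :
    (a + b) ^ n = qFactorial z n •
      ∑ p ∈ antidiagonal n, qBinomTerm z p.1 p.2 • (a ^ p.1 * b ^ p.2) := by
  induction n with
  | zero => simp [qBinomTerm, qFactorial]
  | succ n ih =>
    have ha : ∑ p ∈ antidiagonal n, qBinomTerm z p.1 p.2 • (a * (a ^ p.1 * b ^ p.2)) =
        ∑ p ∈ antidiagonal (n + 1),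
          (z⁻¹ ^ p.2 * qInt z p.1 * qBinomTerm z p.1 p.2) • (a ^ p.1 * b ^ p.2) := by
      rw [Nat.sum_antidiagonal_succ]
      simp only [qInt_zero, mul_zero, zero_mul, zero_smul, zero_add]
      refine sum_congr rfl fun p _ => ?_
      rw [mul_assoc (z⁻¹ ^ p.2), qInt_mul_qBinomTerm hz, ← mul_assoc (z⁻¹ ^ p.2), ← mul_pow,
        inv_mul_cancel₀ hz.ne_zero, one_pow, one_mul, pow_succ' a, mul_assoc]
    have hb : ∑ p ∈ antidiagonal n, qBinomTerm z p.1 p.2 • (b * (a ^ p.1 * b ^ p.2)) =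
        ∑ p ∈ antidiagonal (n + 1),
          (z ^ p.1 * qInt z p.2 * qBinomTerm z p.1 p.2) • (a ^ p.1 * b ^ p.2) := by
      rw [Nat.sum_antidiagonal_succ']
      simp only [qInt_zero, mul_zero, zero_mul, zero_smul, zero_add]
      refine sum_congr rfl fun p _ => ?_
      rw [mul_assoc (z ^ p.1), qBinomTerm_comm z p.1 (p.2 + 1), qInt_mul_qBinomTerm hz,
        qBinomTerm_comm z p.2, ← mul_assoc, ← mul_assoc, mul_pow_of_mul_eq_smul hab,
        smul_mul_assoc, smul_smul, mul_assoc, ← pow_succ' b]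
      congr 1
      ring
    rw [pow_succ', ih, mul_smul_comm, add_mul, mul_sum, mul_sum, qFactorial_succ, mul_smul]
    simp only [mul_smul_comm]
    rw [ha, hb, ← sum_add_distrib, smul_sum (r := qInt z (n + 1))]
    congr 1
    refine sum_congr rfl fun p hp => ?_
    rw [← mem_antidiagonal.mp hp, qInt_add, ← add_smul, smul_smul]
    congr 1
    ring

open Finset in
theorem add_pow_eq_sum_qBinom {z : ℂ} (hz : IsGeneric z) {a b : A}
    (hab : b * a = z ^ 2 • (a * b)) (n : ℕ) :
    (a + b) ^ n =
      ∑ p ∈ antidiagonal n, (z ^ (p.1 * p.2) * qBinom z n p.1) • (a ^ p.1 * b ^ p.2) := by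
  rw [add_pow_eq_sum_qBinomTerm hz hab, smul_sum]
  refine sum_congr rfl fun p hp => ?_
  rw [smul_smul, qBinom, qBinomTerm, ← mem_antidiagonal.mp hp, Nat.add_sub_cancel_left]
  congr 1
  ring

end QBinomial

section SkewAdjoint

variable {R A : Type*} [CommRing R] [Ring A] [Algebra R A]

/-- The `σ`-skew commutator `Y ↦ a Y - σ(Y) a` with `a`, for an endomorphism `σ` of the algebra.
When `σ` is conjugation by a group-like element, it is the adjoint action of a skew-primitive
element. -/
def skewAd (σ : A →ₐ[R] A) (a : A) : Module.End R A :=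
  LinearMap.mulLeft R a - LinearMap.mulRight R a ∘ₗ σ.toLinearMap

lemma skewAd_apply (σ : A →ₐ[R] A) (a Y : A) : skewAd σ a Y = a * Y - σ Y * a := by
  simp [skewAd]

lemma skewAd_apply_of_eq_smul {σ : A →ₐ[R] A} {Y : A} {t : R} (hY : σ Y = t • Y) (a : A) :
    skewAd σ a Y = a * Y - t • (Y * a) := by
  rw [skewAd_apply, hY, smul_mul_assoc]

lemma skewAd_mul (σ : A →ₐ[R] A) (a Y Z : A) :
    skewAd σ a (Y * Z) = skewAd σ a Y * Z + σ Y * skewAd σ a Z := by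
  simp only [skewAd_apply, map_mul]
  noncomm_ring

lemma smul_skewAd_skewAd_sub {σ τ : A →ₐ[R] A} (hστ : σ.comp τ = τ.comp σ) {a x : A} {p : R}
    (hx : p • σ x = x) (ha : τ a = p • a) (Y : A) :
    p • skewAd σ a (skewAd τ x Y) - skewAd τ x (skewAd σ a Y) =
      skewAd (σ.comp τ) (p • (a * x) - x * a) Y := by
  have hxY : p • (σ x * σ Y * a) = x * σ Y * a := by
    rw [← smul_mul_assoc, ← smul_mul_assoc, hx]
  have hYτ : p • (τ (σ Y) * σ x * a) = τ (σ Y) * x * a := by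
    rw [← smul_mul_assoc, ← mul_smul_comm, hx]
  have hcomm : σ (τ Y) = τ (σ Y) := DFunLike.congr_fun hστ Y
  simp only [skewAd_apply, map_mul, map_sub, mul_sub, sub_mul, smul_sub, hcomm, ha,
    AlgHom.comp_apply, smul_mul_assoc, mul_smul_comm, ← mul_assoc, hxY, hYτ]
  abel

lemma map_skewAd {σ : A →ₐ[R] A} {a : A} {t : R} (ha : σ a = t • a) (Y : A) :
    σ (skewAd σ a Y) = t • skewAd σ a (σ Y) := by
  simp only [skewAd_apply, map_sub, map_mul, ha, smul_mul_assoc, mul_smul_comm, smul_sub]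

lemma mem_maxGenEigenspace_zero_iff {M : Type*} [AddCommGroup M] [Module R M]
    {f : Module.End R M} {x : M} : x ∈ f.maxGenEigenspace 0 ↔ ∃ n : ℕ, (f ^ n) x = 0 := by
  simp [Module.End.mem_maxGenEigenspace]

lemma apply_mem_maxGenEigenspace_zero_iff {M : Type*} [AddCommGroup M] [Module R M]
    {f : Module.End R M} {x : M} : f x ∈ f.maxGenEigenspace 0 ↔ x ∈ f.maxGenEigenspace 0 := by
  simp only [mem_maxGenEigenspace_zero_iff, ← Module.End.mul_apply, ← pow_succ]
  refine ⟨fun ⟨n, hn⟩ => ⟨n + 1, hn⟩, fun ⟨n, hn⟩ => ⟨n, ?_⟩⟩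
  rw [pow_succ', Module.End.mul_apply, hn, map_zero]

section Field

variable {K B : Type*} [Field K] [Ring B] [Algebra K B] {σ : B →ₐ[K] B} {a : B} {t : K}

lemma skewAd_pow_map_eq_zero (ht : t ≠ 0) (ha : σ a = t • a) {n : ℕ} {Y : B}
    (hY : (skewAd σ a ^ n) Y = 0) : (skewAd σ a ^ n) (σ Y) = 0 := by
  have hmap : ∀ m Y, σ ((skewAd σ a ^ m) Y) = t ^ m • (skewAd σ a ^ m) (σ Y) := by
    intro m
    induction m with
    | zero => simp
    | succ m ih =>
      intro Y
      rw [pow_succ, Module.End.mul_apply, ih, map_skewAd ha, map_smul, smul_smul, ← pow_succ,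
        Module.End.mul_apply]
  have := hmap n Y
  rw [hY, map_zero, eq_comm, smul_eq_zero] at this
  exact this.resolve_left (pow_ne_zero _ ht)

lemma mul_mem_maxGenEigenspace_skewAd (ht : t ≠ 0) (ha : σ a = t • a) {Y Z : B}
    (hY : Y ∈ (skewAd σ a).maxGenEigenspace 0) (hZ : Z ∈ (skewAd σ a).maxGenEigenspace 0) :
    Y * Z ∈ (skewAd σ a).maxGenEigenspace 0 := by
  obtain ⟨n, hn⟩ := mem_maxGenEigenspace_zero_iff.mp hY
  obtain ⟨m, hm⟩ := mem_maxGenEigenspace_zero_iff.mp hZ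
  clear hY hZ
  induction n generalizing Y Z m with
  | zero => simp_all
  | succ n ihn =>
    induction m generalizing Y Z with
    | zero => simp_all
    | succ m ihm =>
      rw [← apply_mem_maxGenEigenspace_zero_iff, skewAd_mul]
      exact add_mem (ihn (by rwa [pow_succ, Module.End.mul_apply] at hn) _ hm)
        (ihm (skewAd_pow_map_eq_zero ht ha hn) (by rwa [pow_succ, Module.End.mul_apply] at hm))

end Field

section Complex

open Finset

variable {B : Type*} [Ring B] [Algebra ℂ B] {σ : B →ₐ[ℂ] B} {a Y : B} {z t : ℂ}

lemma neg_mulRight_comp_pow_apply (ha : σ a = z ^ 2 • a) (hY : σ Y = t • Y) (hz : z ≠ 0)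
    (m : ℕ) :
    ((-(LinearMap.mulRight ℂ a ∘ₗ σ.toLinearMap) : Module.End ℂ B) ^ m) Y =
      ((-(z⁻¹ * t)) ^ m * z ^ (m * m)) • (Y * a ^ m) := by
  induction m with
  | zero => simp
  | succ m ih =>
    have hcoeff : -((-(z⁻¹ * t)) ^ m * z ^ (m * m) * (t * (z ^ 2) ^ m)) =
        (-(z⁻¹ * t)) ^ (m + 1) * z ^ ((m + 1) * (m + 1)) := by
      rw [show (m + 1) * (m + 1) = m * m + 2 * m + 1 by ring, pow_add z, pow_add z, pow_mul z 2 m]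
      rw [pow_succ (-(z⁻¹ * t))]
      field_simp
    rw [pow_succ', Module.End.mul_apply, ih, map_smul, LinearMap.neg_apply, LinearMap.comp_apply,
      AlgHom.toLinearMap_apply, LinearMap.mulRight_apply, map_mul, map_pow, hY, ha, smul_pow,
      smul_mul_smul_comm, smul_mul_assoc, mul_assoc Y, ← pow_succ, smul_neg, smul_smul,
      ← neg_smul, hcoeff]

/-- The operators of left and of skew right multiplication by `a` satisfy the hypothesis of the
`q`-binomial formula. -/
theorem skewAd_pow_apply (hz : IsGeneric z) (ha : σ a = z ^ 2 • a) (hY : σ Y = t • Y) (n : ℕ) :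
    (skewAd σ a ^ n) Y = ∑ p ∈ antidiagonal n,
      ((-(z ^ n * z⁻¹ * t)) ^ p.2 * qBinom z n p.1) • (a ^ p.1 * Y * a ^ p.2) := by
  set S : Module.End ℂ B := LinearMap.mulRight ℂ a ∘ₗ σ.toLinearMap with hS
  have hcomm : -S * LinearMap.mulLeft ℂ a = z ^ 2 • (LinearMap.mulLeft ℂ a * -S) := by
    ext y
    simp [hS, ha, mul_assoc]
  rw [skewAd, sub_eq_add_neg, add_pow_eq_sum_qBinom hz hcomm, LinearMap.sum_apply]
  refine sum_congr rfl fun p hp => ?_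
  have hcoeff : z ^ (p.1 * p.2) * qBinom z n p.1 * ((-(z⁻¹ * t)) ^ p.2 * z ^ (p.2 * p.2)) =
      (-(z ^ n * z⁻¹ * t)) ^ p.2 * qBinom z n p.1 := by
    have hneg : -(z ^ n * z⁻¹ * t) = z ^ n * -(z⁻¹ * t) := by ring
    rw [hneg, mul_pow, ← pow_mul, ← mem_antidiagonal.mp hp, add_mul, pow_add]
    ring
  rw [LinearMap.smul_apply, Module.End.mul_apply, LinearMap.pow_mulLeft, LinearMap.mulLeft_apply,
    neg_mulRight_comp_pow_apply ha hY hz.ne_zero, mul_smul_comm, smul_smul, hcoeff,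
    ← mul_assoc]

end Complex

end SkewAdjoint

section Strings

variable {K U : Type*} [Field K] [AddCommGroup U] [Module K U]

/-- A family `N k` of weight spaces, of weight `b + 2 k`, on which `F` raises and `E` lowers the
degree and which satisfies the quantum `𝔰𝔩₂`-relation between `E` and `F`. -/
structure IsWeightString (z c : K) (E F : Module.End K U) (N : ℤ → Submodule K U) (b : ℤ) :
    Prop where
  mapE {k : ℤ} {y : U} (hy : y ∈ N k) : E y ∈ N (k - 1)
  mapF {k : ℤ} {y : U} (hy : y ∈ N k) : F y ∈ N (k + 1)
  rel {k : ℤ} {y : U} (hy : y ∈ N k) :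
    z ^ (-2 : ℤ) • E (F y) - F (E y) = (c * (1 - z ^ (2 * (b + 2 * k)))) • y

/-- The scalar by which `E * F ^ (n + 1)` differs from `F ^ n` on a vector of weight `b` killed by
`E`. -/
def stringCoeff (z c : K) (b : ℤ) (n : ℕ) : K :=
  z ^ 2 * c * (1 - z ^ 2)⁻¹ * (1 - z ^ (2 * (n + 1 : ℤ))) * (1 - z ^ (2 * (n + b)))

lemma stringCoeff_ne_zero {z c : K} (hz : IsGeneric z) (hc : c ≠ 0) {b : ℤ} {n : ℕ}
    (hn : n + b ≠ 0) : stringCoeff z c b n ≠ 0 := by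
  have h2 : 1 - z ^ 2 ≠ 0 := sub_ne_zero.mpr (hz.pow_ne_one 2 two_pos).symm
  exact mul_ne_zero (mul_ne_zero (mul_ne_zero (mul_ne_zero (pow_ne_zero 2 hz.ne_zero) hc)
    (inv_ne_zero h2)) (hz.one_sub_zpow_ne_zero (by omega))) (hz.one_sub_zpow_ne_zero (by omega))

lemma stringCoeff_zero {z c : K} (hz : IsGeneric z) (b : ℤ) :
    stringCoeff z c b 0 = z ^ 2 * (c * (1 - z ^ (2 * b))) := by
  have h2 : 1 - z ^ 2 ≠ 0 := sub_ne_zero.mpr (hz.pow_ne_one 2 two_pos).symm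
  simp only [stringCoeff, Nat.cast_zero, zero_add, mul_one, zpow_ofNat]
  field_simp

lemma stringCoeff_succ {z c : K} (hz : IsGeneric z) (b : ℤ) (n : ℕ) :
    stringCoeff z c b (n + 1) =
      z ^ 2 * (stringCoeff z c b n + c * (1 - z ^ (2 * (b + 2 * (n + 1 : ℤ))))) := by
  have h2 : 1 - z ^ 2 ≠ 0 := sub_ne_zero.mpr (hz.pow_ne_one 2 two_pos).symm
  have h0 := hz.ne_zero
  have e1 : z ^ (2 * ((n : ℤ) + 1)) = z ^ (2 * (n : ℤ)) * z ^ 2 := by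
    rw [mul_add, zpow_add₀ h0, mul_one, zpow_ofNat]
  have e2 : z ^ (2 * ((n : ℤ) + 1 + 1)) = z ^ (2 * (n : ℤ)) * z ^ 4 := by
    rw [add_assoc, mul_add, zpow_add₀ h0, ← zpow_ofNat z 4]; norm_num
  have e3 : z ^ (2 * ((n : ℤ) + b)) = z ^ (2 * (n : ℤ)) * z ^ (2 * b) := by
    rw [mul_add, zpow_add₀ h0]
  have e4 : z ^ (2 * ((n : ℤ) + 1 + b)) = z ^ (2 * (n : ℤ)) * z ^ 2 * z ^ (2 * b) := by
    rw [mul_add, zpow_add₀ h0, e1]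
  have e5 : z ^ (2 * (b + 2 * ((n : ℤ) + 1))) = z ^ (2 * b) * (z ^ (2 * (n : ℤ)) * z ^ 2) ^ 2 := by
    rw [← e1, mul_add, zpow_add₀ h0, ← zpow_natCast (z ^ _), ← zpow_mul]
    congr 2
    push_cast
    ring
  simp only [stringCoeff, Nat.cast_add, Nat.cast_one, e1, e2, e3, e4, e5]
  field_simp
  ring

lemma eq_of_le_of_finrank_eq_one {p N : Submodule K U} (hN : Module.finrank K N = 1) (hp : p ≠ ⊥)
    (hle : p ≤ N) : p = N := by
  have : FiniteDimensional K N := Module.finite_of_finrank_eq_succ hN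
  have : FiniteDimensional K p := Submodule.finiteDimensional_of_le hle
  exact Submodule.eq_of_le_of_finrank_le hle (hN.trans_le (Submodule.one_le_finrank_iff.mpr hp))

namespace IsWeightString

variable {z c : K} {E F : Module.End K U} {N : ℤ → Submodule K U} {b : ℤ}
  (h : IsWeightString z c E F N b)
include h

lemma symm (hz : z ≠ 0) :
    IsWeightString z⁻¹ (-(z ^ 2 * c)) F E (fun k => N (-k)) (-b) where
  mapE {k y} hy := by
    rw [show -(k - 1) = -k + 1 by ring]
    exact h.mapF hy
  mapF {k y} hy := by
    rw [show -(k + 1) = -k - 1 by ring]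
    exact h.mapE hy
  rel {k y} hy := by
    have hweight : z⁻¹ ^ (2 * (-b + 2 * k)) = z ^ (2 * (b + 2 * -k)) := by
      rw [inv_zpow']
      congr 1
      ring
    have hz2 : z⁻¹ ^ (-2 : ℤ) = z ^ 2 := by simp [zpow_ofNat]
    have hz2' : z ^ 2 * z ^ (-2 : ℤ) = 1 := by
      rw [zpow_neg, zpow_ofNat, mul_inv_cancel₀ (pow_ne_zero 2 hz)]
    rw [hweight, hz2, neg_mul, neg_smul, mul_assoc, mul_smul, ← h.rel hy, smul_sub, smul_smul,
      hz2', one_smul, neg_sub]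

lemma pow_F_mem {k : ℤ} {y : U} (hy : y ∈ N k) (n : ℕ) : (F ^ n) y ∈ N (k + n) := by
  induction n with
  | zero => simpa
  | succ n ih =>
    rw [pow_succ', Module.End.mul_apply, Nat.cast_succ, ← add_assoc]
    exact h.mapF ih

lemma pow_E_mem {k : ℤ} {y : U} (hy : y ∈ N k) (n : ℕ) : (E ^ n) y ∈ N (k - n) := by
  induction n with
  | zero => simpa
  | succ n ih =>
    rw [pow_succ', Module.End.mul_apply, Nat.cast_succ, ← sub_sub]
    exact h.mapE ih

lemma E_pow_F_apply (hz : IsGeneric z) {k : ℤ} {y : U} (hy : y ∈ N k) (hEy : E y = 0) (n : ℕ) :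
    E ((F ^ (n + 1)) y) = stringCoeff z c (b + 2 * k) n • (F ^ n) y := by
  have hEF {j : ℤ} {x : U} (hx : x ∈ N j) :
      E (F x) = z ^ 2 • (F (E x) + (c * (1 - z ^ (2 * (b + 2 * j)))) • x) := by
    rw [← h.rel hx, add_sub_cancel, smul_smul, zpow_neg, zpow_ofNat,
      mul_inv_cancel₀ (pow_ne_zero 2 hz.ne_zero), one_smul]
  induction n with
  | zero =>
    rw [zero_add, pow_one, hEF hy, hEy, map_zero, zero_add, stringCoeff_zero hz, smul_smul,
      pow_zero, Module.End.one_apply]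
  | succ n ih =>
    rw [pow_succ', Module.End.mul_apply, hEF (h.pow_F_mem hy (n + 1)), ih, map_smul,
      ← Module.End.mul_apply F, ← pow_succ', ← add_smul, smul_smul, stringCoeff_succ hz]
    congr 4
    push_cast
    ring_nf

lemma exists_pow_F_apply_ne_zero (hz : IsGeneric z) (hc : c ≠ 0) {k : ℤ} {y : U} (hy : y ∈ N k)
    (hEy : E y = 0) (hFy : y ∈ F.maxGenEigenspace 0) (hy0 : y ≠ 0) :
    ∃ n : ℕ, (n : ℤ) = -(b + 2 * k) ∧ (F ^ n) y ≠ 0 := by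
  classical
  have hex := mem_maxGenEigenspace_zero_iff.mp hFy
  obtain ⟨n, hn⟩ : ∃ n, Nat.find hex = n + 1 :=
    Nat.exists_eq_succ_of_ne_zero fun h0 => hy0 (by simpa [h0] using Nat.find_spec hex)
  have hFn : (F ^ n) y ≠ 0 := Nat.find_min hex (by omega)
  refine ⟨n, ?_, hFn⟩
  by_contra hne
  have hEF := h.E_pow_F_apply hz hy hEy n
  rw [← hn, Nat.find_spec hex, map_zero, eq_comm, smul_eq_zero] at hEF
  exact hEF.elim (stringCoeff_ne_zero hz hc (by omega)) hFn

lemma pow_F_apply_ne_zero (hz : IsGeneric z) (hc : c ≠ 0) {k : ℤ} {y : U} (hy : y ∈ N k)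
    (hEy : E y = 0) (hFy : y ∈ F.maxGenEigenspace 0) (hy0 : y ≠ 0) {n : ℕ}
    (hn : n ≤ -(b + 2 * k)) : (F ^ n) y ≠ 0 := by
  obtain ⟨m, hm, hFm⟩ := h.exists_pow_F_apply_ne_zero hz hc hy hEy hFy hy0
  obtain ⟨j, rfl⟩ := Nat.exists_eq_add_of_le' (show n ≤ m by omega)
  intro h0
  rw [pow_add, Module.End.mul_apply, h0, map_zero] at hFm
  exact hFm rfl

lemma eq_zero_of_E_apply_eq_zero (hz : IsGeneric z) (hc : c ≠ 0) {k : ℤ} (hk : 0 < b + 2 * k)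
    {y : U} (hy : y ∈ N k) (hEy : E y = 0) (hFy : y ∈ F.maxGenEigenspace 0) : y = 0 := by
  by_contra hy0
  obtain ⟨n, hn, -⟩ := h.exists_pow_F_apply_ne_zero hz hc hy hEy hFy hy0
  omega

variable (hF : ∀ k, N k ≤ F.maxGenEigenspace 0) {s : ℤ} (hs : ∀ k < s, N k = ⊥)

include hs in
lemma le_maxGenEigenspace_E (k : ℤ) : N k ≤ E.maxGenEigenspace 0 := by
  intro y hy
  refine mem_maxGenEigenspace_zero_iff.mpr ⟨(k - s).toNat + 1, ?_⟩
  have hmem := h.pow_E_mem hy ((k - s).toNat + 1)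
  rwa [hs _ (by omega), Submodule.mem_bot] at hmem

include hF hs

lemma eq_bot_of_lt (hz : IsGeneric z) (hc : c ≠ 0) {k : ℤ} (hk : -b - s < k) : N k = ⊥ := by
  have hinj {j : ℤ} (hj : -b - s < j) {y : U} (hy : y ∈ N j) (hFy : F y = 0) : y = 0 := by
    by_contra hy0
    have hE := h.le_maxGenEigenspace_E hs j hy
    rw [← neg_neg j] at hy
    obtain ⟨n, hn, hEn⟩ := (h.symm hz.ne_zero).exists_pow_F_apply_ne_zero hz.inv
      (neg_ne_zero.mpr (mul_ne_zero (pow_ne_zero 2 hz.ne_zero) hc)) hy hFy hE hy0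
    have hmem := h.pow_E_mem hy n
    rw [hs _ (by omega), Submodule.mem_bot] at hmem
    exact hEn hmem
  refine (Submodule.eq_bot_iff _).mpr fun y hy => ?_
  obtain ⟨n, hn⟩ := mem_maxGenEigenspace_zero_iff.mp (hF k hy)
  induction n with
  | zero => simpa using hn
  | succ n ih =>
    rw [pow_succ', Module.End.mul_apply] at hn
    exact ih (hinj (by omega) (h.pow_F_mem hy n) hn)

lemma exists_pow_F_apply_mem (hz : IsGeneric z) (hc : c ≠ 0) (hNs : N s ≠ ⊥) :
    ∃ y ∈ N s, E y = 0 ∧ ∀ n : ℕ, s + n ≤ -b - s → (F ^ n) y ≠ 0 := by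
  obtain ⟨y, hy, hy0⟩ := (Submodule.ne_bot_iff _).mp hNs
  have hEy : E y = 0 := by
    have hmem := h.mapE hy
    rwa [hs _ (by omega), Submodule.mem_bot] at hmem
  exact ⟨y, hy, hEy, fun n hn => h.pow_F_apply_ne_zero hz hc hy hEy (hF s hy) hy0 (by omega)⟩

lemma finrank_eq_one (hz : IsGeneric z) (hc : c ≠ 0) {k : ℤ} (hsk : s ≤ k) (hk : k ≤ -b - s)
    (hbk : 0 < b + 2 * k) (hNs : N s ≠ ⊥) (hNk : Module.finrank K (N (k - 1)) = 1) :
    Module.finrank K (N k) = 1 := by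
  have : FiniteDimensional K (N (k - 1)) := Module.finite_of_finrank_eq_succ hNk
  let f : N k →ₗ[K] N (k - 1) := E.restrict fun _ hy => h.mapE hy
  have hf : Function.Injective f := by
    refine (injective_iff_map_eq_zero f).mpr fun y hy => Subtype.ext ?_
    exact h.eq_zero_of_E_apply_eq_zero hz hc hbk y.2 (congrArg Subtype.val hy) (hF k y.2)
  have : FiniteDimensional K (N k) := Module.Finite.of_injective f hf
  obtain ⟨y, hy, -, hFy⟩ := h.exists_pow_F_apply_mem hF hs hz hc hNs
  have hne : N k ≠ ⊥ := by
    refine (Submodule.ne_bot_iff _).mpr ⟨_, ?_, hFy (k - s).toNat (by omega)⟩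
    convert h.pow_F_mem hy (k - s).toNat using 2
    omega
  exact le_antisymm ((LinearMap.finrank_le_finrank_of_injective hf).trans_eq hNk)
    (Submodule.one_le_finrank_iff.mpr hne)

lemma map_F_eq_and_map_E_eq (hz : IsGeneric z) (hc : c ≠ 0) {k : ℤ} (hsk : s ≤ k)
    (hk : k + 1 ≤ -b - s) (hNs : N s ≠ ⊥) (hNk : Module.finrank K (N k) = 1)
    (hNk1 : Module.finrank K (N (k + 1)) = 1) :
    (N k).map F = N (k + 1) ∧ (N (k + 1)).map E = N k := by
  obtain ⟨y, hy, hEy, hFy⟩ := h.exists_pow_F_apply_mem hF hs hz hc hNs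
  obtain ⟨n, rfl⟩ : ∃ n : ℕ, k = s + n := ⟨(k - s).toNat, by omega⟩
  have hn : (F ^ n) y ≠ 0 := hFy n (by omega)
  have hn1 : F ((F ^ n) y) ≠ 0 := by
    rw [← Module.End.mul_apply, ← pow_succ']
    exact hFy (n + 1) (by push_cast; omega)
  have hEn : E (F ((F ^ n) y)) ≠ 0 := by
    rw [← Module.End.mul_apply F, ← pow_succ', h.E_pow_F_apply hz hy hEy]
    exact smul_ne_zero (stringCoeff_ne_zero hz hc (by omega)) hn
  have hmem := h.pow_F_mem hy n
  refine ⟨eq_of_le_of_finrank_eq_one hNk1 ?_ ?_, eq_of_le_of_finrank_eq_one hNk ?_ ?_⟩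
  · exact (Submodule.ne_bot_iff _).mpr ⟨_, Submodule.mem_map_of_mem hmem, hn1⟩
  · exact Submodule.map_le_iff_le_comap.mpr fun x hx => h.mapF hx
  · exact (Submodule.ne_bot_iff _).mpr ⟨_, Submodule.mem_map_of_mem (h.mapF hmem), hEn⟩
  · refine Submodule.map_le_iff_le_comap.mpr fun x hx => ?_
    simpa using h.mapE hx

end IsWeightString

end Strings

section Relations

variable {I : Type*} (C : Matrix I I ℤ) (d : I → ℕ) (q : ℂ)

/-- The element `φ̃⁺_{i,m} = k_i⁻¹ φ⁺_{i,m}`. -/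
def phiTilde (i : I) (m : ℕ) : LoopAlgebra C d q := LoopAlgebra.mk C d q (fphiP i m)

variable {C d q}

lemma mk_eq_of_rel {a b : FreeAlgebra ℂ (Gen I)} (h : Rel C d q a b) :
    LoopAlgebra.mk C d q a = LoopAlgebra.mk C d q b :=
  RingQuot.mkAlgHom_rel ℂ h

lemma kInv_mul_k (i : I) : kInv C d q i * k C d q i = 1 := by
  simpa [k, kInv] using mk_eq_of_rel (.kap_mul_inv (C := C) (d := d) (q := q) i)

lemma k_mul_kInv (i : I) : k C d q i * kInv C d q i = 1 := by
  simpa [k, kInv] using mk_eq_of_rel (.inv_mul_kap (C := C) (d := d) (q := q) i)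

lemma commute_kInv (i j : I) : Commute (kInv C d q i) (kInv C d q j) := by
  simpa [Commute, SemiconjBy, kInv] using
    mk_eq_of_rel (.kap_comm (C := C) (d := d) (q := q) i j)

lemma commute_kInv_phiTilde (i j : I) (m : ℕ) :
    Commute (kInv C d q i) (phiTilde C d q j m) := by
  simpa [Commute, SemiconjBy, kInv, phiTilde] using
    mk_eq_of_rel (.kap_phiP (C := C) (d := d) (q := q) i j m)

lemma commute_phiTilde (i j : I) (m m' : ℕ) :
    Commute (phiTilde C d q i m) (phiTilde C d q j m') := by
  simpa [Commute, SemiconjBy, phiTilde] using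
    mk_eq_of_rel (.phiP_phiP (C := C) (d := d) (q := q) i j m m')

lemma phiTilde_zero (i : I) : phiTilde C d q i 0 = 1 := by
  simpa [phiTilde] using mk_eq_of_rel (.phiP_zero (C := C) (d := d) (q := q) i)

lemma phiPlus_eq (i : I) (m : ℕ) : phiPlus C d q i m = k C d q i * phiTilde C d q i m :=
  map_mul _ _ _

lemma kInv_mul_xPlus (i j : I) (r : ℤ) :
    kInv C d q i * xPlus C d q j r =
      (q ^ d i) ^ (-C i j) • (xPlus C d q j r * kInv C d q i) := by
  simpa [kInv, xPlus, qpow] using mk_eq_of_rel (.kap_x (C := C) (d := d) (q := q) 1 i j r)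

lemma kInv_mul_xTildeMinus (i j : I) (r : ℤ) :
    kInv C d q i * xTildeMinus C d q j r =
      (q ^ d i) ^ C i j • (xTildeMinus C d q j r * kInv C d q i) := by
  simpa [kInv, xTildeMinus, qpow] using
    mk_eq_of_rel (.kap_x (C := C) (d := d) (q := q) (-1) i j r)

lemma phiTilde_one_mul_x (ε : ℤˣ) (i j : I) (r : ℤ) :
    phiTilde C d q i 1 * LoopAlgebra.mk C d q (fx ε j r) =
      LoopAlgebra.mk C d q (fx ε j r) * phiTilde C d q i 1 +
        ((q ^ d i) ^ (ε * C i j) - (q ^ d i) ^ (-(ε * C i j))) •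
          LoopAlgebra.mk C d q (fx ε j (r + 1)) := by
  have hrel := mk_eq_of_rel (.phiP_x (C := C) (d := d) (q := q) ε i j 1 r)
  have hzero := phiTilde_zero (C := C) (d := d) (q := q) i
  rw [phiTilde] at hzero
  simp only [Finset.sum_range_succ, Finset.sum_range_zero, map_mul, map_add, map_sub, map_smul,
    Nat.sub_self, Nat.sub_zero, hzero, zero_add, qpow, Nat.cast_zero, Nat.cast_one, mul_zero,
    zero_mul, zpow_zero, one_smul, add_zero, mul_one, zero_sub, mul_neg, neg_mul] at hrel
  rw [phiTilde, hrel, sub_smul, add_sub_assoc]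

lemma phiTilde_one_mul_xPlus (i j : I) (r : ℤ) :
    phiTilde C d q i 1 * xPlus C d q j r = xPlus C d q j r * phiTilde C d q i 1 +
      ((q ^ d i) ^ C i j - (q ^ d i) ^ (-C i j)) • xPlus C d q j (r + 1) := by
  simpa [xPlus] using phiTilde_one_mul_x 1 i j r

lemma phiTilde_one_mul_xTildeMinus (i j : I) (r : ℤ) :
    phiTilde C d q i 1 * xTildeMinus C d q j r = xTildeMinus C d q j r * phiTilde C d q i 1 +
      ((q ^ d i) ^ (-C i j) - (q ^ d i) ^ C i j) • xTildeMinus C d q j (r + 1) := by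
  simpa [xTildeMinus] using phiTilde_one_mul_x (-1) i j r

lemma smul_xPlus_mul_xTildeMinus_sub (i : I) {r r' : ℤ} (h : 0 < r + r') :
    (q ^ d i) ^ (-C i i) • (xPlus C d q i r * xTildeMinus C d q i r') -
        xTildeMinus C d q i r' * xPlus C d q i r =
      (q ^ d i - (q ^ d i)⁻¹)⁻¹ • phiTilde C d q i (r + r').toNat := by
  simpa [xPlus, xTildeMinus, phiTilde, qpow, fphiPZ, fphiMZ, h.le, h.not_ge] using
    mk_eq_of_rel (.xP_xM_same (C := C) (d := d) (q := q) i r r')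

lemma smul_xPlus_zero_mul_xTildeMinus_zero_sub (i : I) :
    (q ^ d i) ^ (-C i i) • (xPlus C d q i 0 * xTildeMinus C d q i 0) -
        xTildeMinus C d q i 0 * xPlus C d q i 0 =
      (q ^ d i - (q ^ d i)⁻¹)⁻¹ • (1 - kInv C d q i ^ 2) := by
  have hP := mk_eq_of_rel (.phiP_zero (C := C) (d := d) (q := q) i)
  have hM := mk_eq_of_rel (.phiM_zero (C := C) (d := d) (q := q) i)
  simpa [xPlus, xTildeMinus, kInv, qpow, fphiPZ, fphiMZ, hP, hM] using
    mk_eq_of_rel (.xP_xM_same (C := C) (d := d) (q := q) i 0 0)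

lemma smul_xPlus_mul_xTildeMinus_of_ne {i j : I} (hij : i ≠ j) (r r' : ℤ) :
    (q ^ d i) ^ (-C i j) • (xPlus C d q i r * xTildeMinus C d q j r') =
      xTildeMinus C d q j r' * xPlus C d q i r := by
  have hrel := mk_eq_of_rel (.xP_xM_ne (C := C) (d := d) (q := q) i j r r' hij)
  rw [map_zero, map_sub, sub_eq_zero] at hrel
  simpa [xPlus, xTildeMinus, qpow] using hrel

lemma xTildeMinus_one_mul_xTildeMinus_zero (i : I) :
    xTildeMinus C d q i 1 * xTildeMinus C d q i 0 =
      (q ^ d i) ^ (-C i i) • (xTildeMinus C d q i 0 * xTildeMinus C d q i 1) := by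
  have hrel := mk_eq_of_rel (.x_x (C := C) (d := d) (q := q) (-1) i i 0 0)
  simp only [map_sub, map_mul, map_smul, qpow, zero_add, Units.val_neg, Units.val_one,
    neg_one_mul] at hrel
  have htwo : (2 : ℂ) • (xTildeMinus C d q i 1 * xTildeMinus C d q i 0 -
      (q ^ d i) ^ (-C i i) • (xTildeMinus C d q i 0 * xTildeMinus C d q i 1)) = 0 := by
    rw [two_smul, ← eq_neg_iff_add_eq_zero, neg_sub]
    exact hrel
  exact sub_eq_zero.mp ((smul_eq_zero_iff_right two_ne_zero).mp htwo)

open Finset in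
lemma sum_antidiagonal_serre {i j : I} (hij : i ≠ j) (r : ℤ) :
    ∑ p ∈ antidiagonal (1 - C i j).toNat,
      ((-1) ^ p.1 * qBinom (q ^ d i) (1 - C i j).toNat p.1) •
        (xTildeMinus C d q i 0 ^ p.1 * xTildeMinus C d q j r * xTildeMinus C d q i 0 ^ p.2) =
      0 := by
  have hrel := mk_eq_of_rel (.serre (C := C) (d := d) (q := q) (-1) i j hij (fun _ => 0) r)
  set s := (1 - C i j).toNat
  simp only [serreSum, List.ofFn_const, List.take_replicate, List.drop_replicate,
    List.prod_replicate, sum_const, map_zero, map_nsmul, map_sum, map_smul, map_mul,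
    map_pow] at hrel
  rw [← Nat.cast_smul_eq_nsmul ℂ, smul_eq_zero_iff_right (by simp [Fintype.card_ne_zero])] at hrel
  rw [Nat.sum_antidiagonal_eq_sum_range_succ_mk, ← hrel]
  refine sum_congr rfl fun n hn => ?_
  rw [min_eq_left (Nat.lt_succ_iff.mp (mem_range.mp hn)), xTildeMinus, xTildeMinus]

end Relations

section KappaConjugation

variable {I : Type*} (C : Matrix I I ℤ) (d : I → ℕ) (q : ℂ)

/-- The automorphism `Y ↦ k_i⁻¹ Y k_i` of the quantum loop algebra. -/
def kappaConj (i : I) : LoopAlgebra C d q →ₐ[ℂ] LoopAlgebra C d q :=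
  MulSemiringAction.toAlgHom ℂ _ <| ConjAct.toConjAct
    (⟨kInv C d q i, k C d q i, kInv_mul_k i, k_mul_kInv i⟩ : (LoopAlgebra C d q)ˣ)

variable {C d q}

lemma kappaConj_apply (i : I) (Y : LoopAlgebra C d q) :
    kappaConj C d q i Y = kInv C d q i * Y * k C d q i :=
  rfl

lemma kappaConj_eq_smul_iff {i : I} {Y : LoopAlgebra C d q} {t : ℂ} :
    kappaConj C d q i Y = t • Y ↔ kInv C d q i * Y = t • (Y * kInv C d q i) := by
  rw [kappaConj_apply]
  constructor <;> intro h
  · rw [← smul_mul_assoc, ← h, mul_assoc, k_mul_kInv, mul_one]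
  · rw [h, smul_mul_assoc, mul_assoc, kInv_mul_k, mul_one]

lemma kappaConj_eq_self_iff {i : I} {Y : LoopAlgebra C d q} :
    kappaConj C d q i Y = Y ↔ Commute (kInv C d q i) Y := by
  simpa [Commute, SemiconjBy] using kappaConj_eq_smul_iff (i := i) (Y := Y) (t := 1)

lemma kappaConj_xPlus (i j : I) (r : ℤ) :
    kappaConj C d q i (xPlus C d q j r) = (q ^ d i) ^ (-C i j) • xPlus C d q j r :=
  kappaConj_eq_smul_iff.mpr (kInv_mul_xPlus i j r)

lemma kappaConj_xTildeMinus (i j : I) (r : ℤ) :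
    kappaConj C d q i (xTildeMinus C d q j r) = (q ^ d i) ^ C i j • xTildeMinus C d q j r :=
  kappaConj_eq_smul_iff.mpr (kInv_mul_xTildeMinus i j r)

lemma commute_kInv_k (i j : I) : Commute (kInv C d q i) (k C d q j) :=
  let u : (LoopAlgebra C d q)ˣ := ⟨k C d q j, kInv C d q j, k_mul_kInv j, kInv_mul_k j⟩
  (Commute.units_inv_right_iff (u := u)).mp (commute_kInv i j)

lemma commute_k_of_commute_kInv {i : I} {Y : LoopAlgebra C d q} (h : Commute (kInv C d q i) Y) :
    Commute (k C d q i) Y :=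
  let u : (LoopAlgebra C d q)ˣ := ⟨k C d q i, kInv C d q i, k_mul_kInv i, kInv_mul_k i⟩
  (Commute.units_inv_left_iff (u := u)).mp h

lemma commute_k_k (i j : I) : Commute (k C d q i) (k C d q j) :=
  commute_k_of_commute_kInv (commute_kInv_k i j)

lemma kappaConj_comp_comm (i j : I) :
    (kappaConj C d q i).comp (kappaConj C d q j) =
      (kappaConj C d q j).comp (kappaConj C d q i) := by
  ext Y
  simp only [AlgHom.comp_apply, kappaConj_apply, mul_assoc, (commute_k_k j i).eq]
  rw [← mul_assoc, (commute_kInv i j).eq, mul_assoc]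

end KappaConjugation

section AdjointAction

/-- The properties of a symmetrized Cartan matrix and of a generic parameter `q` on which
computations in the quantum loop algebra rely. -/
structure IsGenericDatum {I : Type*} (C : Matrix I I ℤ) (d : I → ℕ) (q : ℂ) : Prop where
  generic : IsGeneric q
  pos (i : I) : 0 < d i
  symm (i j : I) : (d i : ℤ) * C i j = d j * C j i
  diag (i : I) : C i i = 2
  nonpos {i j : I} (hij : i ≠ j) : C i j ≤ 0

variable {I : Type*} {C : Matrix I I ℤ} {d : I → ℕ} {q : ℂ}

lemma IsGenericDatum.generic_pow (h : IsGenericDatum C d q) (i : I) : IsGeneric (q ^ d i) :=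
  h.generic.pow (h.pos i)

lemma IsGenericDatum.pow_zpow_comm (h : IsGenericDatum C d q) (i j : I) (n : ℤ) :
    (q ^ d i) ^ (n * C i j) = (q ^ d j) ^ (n * C j i) := by
  rw [← zpow_natCast, ← zpow_natCast, ← zpow_mul, ← zpow_mul]
  congr 1
  linear_combination n * h.symm i j

variable (C d q) in
/-- The adjoint action of `x̃⁻_{i,0}`. -/
def adF (i : I) : Module.End ℂ (LoopAlgebra C d q) :=
  skewAd (kappaConj C d q i) (xTildeMinus C d q i 0)

variable (C d q) in
/-- The adjoint action of `x⁺_{i,0}`. -/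
def adE (i : I) : Module.End ℂ (LoopAlgebra C d q) :=
  skewAd (kappaConj C d q i) (xPlus C d q i 0)

lemma adF_phiTilde (i j : I) :
    adF C d q j (phiTilde C d q i 1) =
      ((q ^ d i) ^ C i j - (q ^ d i) ^ (-C i j)) • xTildeMinus C d q j 1 := by
  have hcomm := kappaConj_eq_self_iff.mpr (commute_kInv_phiTilde (C := C) (d := d) (q := q) j i 1)
  rw [adF, skewAd_apply, hcomm, phiTilde_one_mul_xTildeMinus, zero_add]
  module

namespace IsGenericDatum

variable (h : IsGenericDatum C d q)
include h

lemma smul_adE_adF_sub (i j : I) (Y : LoopAlgebra C d q) :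
    (q ^ d i) ^ (-C i j) • adE C d q i (adF C d q j Y) - adF C d q j (adE C d q i Y) =
      skewAd ((kappaConj C d q i).comp (kappaConj C d q j))
        ((q ^ d i) ^ (-C i j) • (xPlus C d q i 0 * xTildeMinus C d q j 0) -
          xTildeMinus C d q j 0 * xPlus C d q i 0) Y := by
  refine smul_skewAd_skewAd_sub (kappaConj_comp_comm i j) ?_ ?_ Y
  · rw [kappaConj_xTildeMinus, smul_smul, ← zpow_add₀ (h.generic_pow i).ne_zero, neg_add_cancel,
      zpow_zero, one_smul]
  · rw [kappaConj_xPlus, ← neg_one_mul (C i j), h.pow_zpow_comm i j, neg_one_mul]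

lemma smul_adE_adF_of_ne {i j : I} (hij : i ≠ j) (Y : LoopAlgebra C d q) :
    (q ^ d i) ^ (-C i j) • adE C d q i (adF C d q j Y) = adF C d q j (adE C d q i Y) := by
  rw [← sub_eq_zero, h.smul_adE_adF_sub, smul_xPlus_mul_xTildeMinus_of_ne hij, sub_self,
    skewAd_apply, zero_mul, mul_zero, sub_zero]

lemma smul_adE_adF_self_sub {i : I} {Y : LoopAlgebra C d q} {n : ℤ}
    (hY : kappaConj C d q i Y = (q ^ d i) ^ n • Y) :
    (q ^ d i) ^ (-2 : ℤ) • adE C d q i (adF C d q i Y) - adF C d q i (adE C d q i Y) =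
      ((q ^ d i - (q ^ d i)⁻¹)⁻¹ * (1 - (q ^ d i) ^ (2 * n))) • Y := by
  have hYY : ((kappaConj C d q i).comp (kappaConj C d q i)) Y = (q ^ d i) ^ (2 * n) • Y := by
    rw [AlgHom.comp_apply, hY, map_smul, hY, smul_smul, ← zpow_add₀ (h.generic_pow i).ne_zero,
      two_mul]
  have hkk : kInv C d q i ^ 2 * Y = (q ^ d i) ^ (2 * n) • (Y * kInv C d q i ^ 2) := by
    rw [pow_two, mul_assoc, kappaConj_eq_smul_iff.mp hY, mul_smul_comm, ← mul_assoc,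
      kappaConj_eq_smul_iff.mp hY, smul_mul_assoc, smul_smul,
      ← zpow_add₀ (h.generic_pow i).ne_zero, two_mul, mul_assoc]
  have hsub := h.smul_adE_adF_sub i i Y
  rw [smul_xPlus_zero_mul_xTildeMinus_zero_sub, h.diag, skewAd_apply_of_eq_smul hYY,
    smul_mul_assoc, mul_smul_comm, sub_mul, mul_sub, hkk, one_mul, mul_one] at hsub
  rw [hsub]
  module

lemma adE_xTildeMinus (i j : I) (r : ℤ) :
    adE C d q i (xTildeMinus C d q j r) =
      (q ^ d i) ^ C i j • ((q ^ d i) ^ (-C i j) • (xPlus C d q i 0 * xTildeMinus C d q j r) -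
        xTildeMinus C d q j r * xPlus C d q i 0) := by
  rw [adE, skewAd_apply_of_eq_smul (kappaConj_xTildeMinus i j r), smul_sub, smul_smul,
    ← zpow_add₀ (h.generic_pow i).ne_zero, add_neg_cancel, zpow_zero, one_smul]

lemma adE_xTildeMinus_of_ne {i j : I} (hij : i ≠ j) (r : ℤ) :
    adE C d q i (xTildeMinus C d q j r) = 0 := by
  rw [h.adE_xTildeMinus, smul_xPlus_mul_xTildeMinus_of_ne hij, sub_self, smul_zero]

lemma adE_xTildeMinus_self (i : I) :
    adE C d q i (xTildeMinus C d q i 1) =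
      ((q ^ d i) ^ C i i * (q ^ d i - (q ^ d i)⁻¹)⁻¹) • phiTilde C d q i 1 := by
  rw [h.adE_xTildeMinus, smul_xPlus_mul_xTildeMinus_sub i (by decide), smul_smul, zero_add,
    Int.toNat_one]

lemma adF_xTildeMinus_self (i : I) : adF C d q i (xTildeMinus C d q i 1) = 0 := by
  rw [adF, skewAd_apply_of_eq_smul (kappaConj_xTildeMinus i i 1),
    xTildeMinus_one_mul_xTildeMinus_zero, smul_smul, ← zpow_add₀ (h.generic_pow i).ne_zero,
    add_neg_cancel, zpow_zero, one_smul, sub_self]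

open Finset in
/-- Since `z ^ (n - 1 + C_{ij}) = 1` for `z = q_i` and `n = 1 - C_{ij}`, the `q`-binomial expansion
of `(ad x̃⁻_{i,0}) ^ n` is the Drinfeld-Serre sum. -/
theorem adF_pow_xTildeMinus {i j : I} (hij : i ≠ j) (r : ℤ) :
    (adF C d q i ^ (1 - C i j).toNat) (xTildeMinus C d q j r) = 0 := by
  have hz := h.generic_pow i
  have hσ : kappaConj C d q i (xTildeMinus C d q i 0) = (q ^ d i) ^ 2 • xTildeMinus C d q i 0 := by
    rw [kappaConj_xTildeMinus, h.diag, zpow_ofNat]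
  have hone : (q ^ d i) ^ (1 - C i j).toNat * (q ^ d i)⁻¹ * (q ^ d i) ^ C i j = 1 := by
    rw [← zpow_natCast, ← zpow_neg_one, ← zpow_add₀ hz.ne_zero, ← zpow_add₀ hz.ne_zero,
      Int.toNat_of_nonneg (by linarith [h.nonpos hij]), show 1 - C i j + -1 + C i j = 0 by ring,
      zpow_zero]
  have hsign {p : ℕ × ℕ} {n : ℕ} (hp : p ∈ antidiagonal n) :
      (-1 : ℂ) ^ p.2 = (-1) ^ n * (-1) ^ p.1 := by
    rw [← mem_antidiagonal.mp hp, pow_add, mul_right_comm, ← mul_pow, neg_one_mul, neg_neg,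
      one_pow, one_mul]
  rw [adF, skewAd_pow_apply hz hσ (kappaConj_xTildeMinus i j r), hone]
  calc
    _ = (-1 : ℂ) ^ (1 - C i j).toNat • ∑ p ∈ antidiagonal (1 - C i j).toNat,
          ((-1) ^ p.1 * qBinom (q ^ d i) (1 - C i j).toNat p.1) • (xTildeMinus C d q i 0 ^ p.1 *
            xTildeMinus C d q j r * xTildeMinus C d q i 0 ^ p.2) := by
      rw [smul_sum]
      refine sum_congr rfl fun p hp => ?_
      rw [hsign hp, smul_smul, mul_assoc]
    _ = 0 := by rw [sum_antidiagonal_serre hij, smul_zero]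

end IsGenericDatum

end AdjointAction

section WordSpaces

variable {I : Type*} {C : Matrix I I ℤ} {d : I → ℕ} {q : ℂ}

lemma kappaConj_iteratedBracket (hq : q ≠ 0) (l : List I) (i j : I) :
    kappaConj C d q i (iteratedBracket C d q l j) =
      (q ^ d i) ^ ((l ++ [j]).map (C i)).sum • iteratedBracket C d q l j := by
  induction l with
  | nil =>
    rw [List.nil_append, List.map_singleton, List.sum_singleton, iteratedBracket,
      kappaConj_xTildeMinus]
  | cons i' l ih =>
    rw [List.cons_append, List.map_cons, List.sum_cons, add_comm, zpow_add₀ (pow_ne_zero _ hq),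
      iteratedBracket, map_sub, map_smul, map_mul, map_mul, ih, kappaConj_xTildeMinus,
      smul_mul_smul_comm, smul_mul_smul_comm, mul_comm ((q ^ d i) ^ C i i'), smul_sub,
      smul_comm]

lemma iteratedBracket_cons (hq : q ≠ 0) (i : I) (l : List I) (j : I) :
    iteratedBracket C d q (i :: l) j = adF C d q i (iteratedBracket C d q l j) := by
  rw [adF, skewAd_apply_of_eq_smul (kappaConj_iteratedBracket hq l i j), iteratedBracket,
    List.sum_map_mul_left, zpow_mul, zpow_natCast]

lemma IsGenericDatum.iteratedBracket_mem_maxGenEigenspace_adF (h : IsGenericDatum C d q) (i : I)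
    (l : List I) (j : I) : iteratedBracket C d q l j ∈ (adF C d q i).maxGenEigenspace 0 := by
  have hx {j : I} (hij : i ≠ j) (r : ℤ) :
      xTildeMinus C d q j r ∈ (adF C d q i).maxGenEigenspace 0 :=
    mem_maxGenEigenspace_zero_iff.mpr ⟨_, h.adF_pow_xTildeMinus hij r⟩
  induction l with
  | nil =>
    rw [iteratedBracket]
    obtain rfl | hij := eq_or_ne i j
    · rw [← apply_mem_maxGenEigenspace_zero_iff, h.adF_xTildeMinus_self]
      exact zero_mem _
    · exact hx hij 1
  | cons i' l ih =>
    obtain rfl | hij := eq_or_ne i i'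
    · rwa [iteratedBracket_cons h.generic.ne_zero, apply_mem_maxGenEigenspace_zero_iff]
    · have ht : (q ^ d i) ^ C i i ≠ 0 := zpow_ne_zero _ (h.generic_pow i).ne_zero
      exact sub_mem (mul_mem_maxGenEigenspace_skewAd ht (kappaConj_xTildeMinus i i 0) (hx hij 0) ih)
        (Submodule.smul_mem _ _
          (mul_mem_maxGenEigenspace_skewAd ht (kappaConj_xTildeMinus i i 0) ih (hx hij 0)))

variable [DecidableEq I]

/-- The sum `α_{i₁} + ⋯ + α_{i_k} + α_j` in coordinates with respect to the simple roots; the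
iterated `q`-commutator attached to the same data has weight `-wordWeight l j`. -/
def wordWeight (l : List I) (j : I) : I → ℤ := (l.map fun i => Pi.single i 1).sum + Pi.single j 1

lemma wordWeight_nil (j : I) : wordWeight [] j = Pi.single j 1 := by
  simp [wordWeight]

lemma wordWeight_cons (i : I) (l : List I) (j : I) :
    wordWeight (i :: l) j = wordWeight l j + Pi.single i 1 := by
  rw [wordWeight, List.map_cons, List.sum_cons, add_comm (Pi.single i 1), add_right_comm,
    wordWeight]

lemma wordWeight_pos (l : List I) (j : I) : 0 < wordWeight l j := by
  induction l with
  | nil => rw [wordWeight_nil, Pi.single_pos]; exact zero_lt_one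
  | cons i l ih =>
    rw [wordWeight_cons]
    exact add_pos_of_pos_of_nonneg ih (Pi.single_nonneg.mpr zero_le_one)

lemma eq_and_eq_one_of_single_eq_smul_single {i j : I} {m : ℤ}
    (hm : (Pi.single j 1 : I → ℤ) = m • Pi.single i 1) : j = i ∧ m = 1 := by
  have hval := congrFun hm j
  obtain rfl | hji := eq_or_ne j i
  · exact ⟨rfl, by simpa using hval.symm⟩
  · simp [hji] at hval

lemma eq_and_eq_of_wordWeight_cons {i i' j : I} {l : List I} {m : ℤ}
    (hl : wordWeight (i' :: l) j = m • Pi.single i 1) :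
    i' = i ∧ wordWeight l j = (m - 1) • Pi.single i 1 := by
  rw [wordWeight_cons] at hl
  have hi : i' = i := by
    by_contra hne
    have hnonneg : 0 ≤ wordWeight l j i' := (wordWeight_pos l j).le i'
    have hval := congrFun hl i'
    simp only [Pi.add_apply, Pi.smul_apply, Pi.single_eq_same, Pi.single_eq_of_ne hne,
      smul_zero] at hval
    omega
  rw [hi] at hl
  exact ⟨hi, by rw [sub_smul, one_smul, ← hl, add_sub_cancel_right]⟩

lemma wordWeight_eq_single_iff {l : List I} {i j : I} :
    wordWeight l j = Pi.single i 1 ↔ l = [] ∧ j = i := by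
  refine ⟨fun h => ?_, fun ⟨hl, hj⟩ => by rw [hl, hj, wordWeight_nil]⟩
  rw [← one_smul ℤ (Pi.single i 1)] at h
  cases l with
  | nil => exact ⟨rfl, (eq_and_eq_one_of_single_eq_smul_single (wordWeight_nil j ▸ h)).1⟩
  | cons i' l =>
    have hzero := (eq_and_eq_of_wordWeight_cons h).2
    rw [sub_self, zero_smul] at hzero
    exact absurd hzero (wordWeight_pos l j).ne'

variable (C d q) in
/-- The span of the iterated `q`-commutators of weight `-β`. -/
def wordSpace (β : I → ℤ) : Submodule ℂ (LoopAlgebra C d q) :=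
  Submodule.span ℂ {Y | ∃ l j, wordWeight l j = β ∧ iteratedBracket C d q l j = Y}

lemma iteratedBracket_mem_wordSpace (l : List I) (j : I) :
    iteratedBracket C d q l j ∈ wordSpace C d q (wordWeight l j) :=
  Submodule.subset_span ⟨l, j, rfl, rfl⟩

lemma wordSpace_le_iff {β : I → ℤ} {p : Submodule ℂ (LoopAlgebra C d q)} :
    wordSpace C d q β ≤ p ↔ ∀ l j, wordWeight l j = β → iteratedBracket C d q l j ∈ p := by
  refine Submodule.span_le.trans ⟨fun h l j hl => h ⟨l, j, hl, rfl⟩, ?_⟩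
  rintro h _ ⟨l, j, hl, rfl⟩
  exact h l j hl

lemma adF_mem_wordSpace (hq : q ≠ 0) (i : I) {β : I → ℤ} {Y : LoopAlgebra C d q}
    (hY : Y ∈ wordSpace C d q β) : adF C d q i Y ∈ wordSpace C d q (β + Pi.single i 1) := by
  have hle : wordSpace C d q β ≤ (wordSpace C d q (β + Pi.single i 1)).comap (adF C d q i) := by
    refine wordSpace_le_iff.mpr fun l j hl => ?_
    rw [Submodule.mem_comap, ← iteratedBracket_cons hq, ← hl, ← wordWeight_cons]
    exact iteratedBracket_mem_wordSpace _ _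
  exact hle hY

/-- The pairing `⟨β, α_i^∨⟩` for `β = ∑ β_j α_j`. -/
def corootPairing [Fintype I] (C : Matrix I I ℤ) (i : I) : (I → ℤ) →ₗ[ℤ] ℤ :=
  LinearMap.proj i ∘ₗ C.mulVecLin

lemma corootPairing_single [Fintype I] (i j : I) : corootPairing C i (Pi.single j 1) = C i j := by
  simp [corootPairing]

lemma corootPairing_wordWeight [Fintype I] (l : List I) (i j : I) :
    corootPairing C i (wordWeight l j) = ((l ++ [j]).map (C i)).sum := by
  rw [wordWeight, map_add, map_list_sum, List.map_map, corootPairing_single, List.map_append,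
    List.sum_append, List.map_singleton, List.sum_singleton]
  simp only [Function.comp_def, corootPairing_single]

lemma kappaConj_of_mem_wordSpace [Fintype I] (hq : q ≠ 0) (i : I) {β : I → ℤ}
    {Y : LoopAlgebra C d q} (hY : Y ∈ wordSpace C d q β) :
    kappaConj C d q i Y = (q ^ d i) ^ corootPairing C i β • Y := by
  have hle : wordSpace C d q β ≤ Module.End.eigenspace (kappaConj C d q i).toLinearMap
      ((q ^ d i) ^ corootPairing C i β) := by
    refine wordSpace_le_iff.mpr fun l j hl => Module.End.mem_eigenspace_iff.mpr ?_
    rw [← hl, corootPairing_wordWeight]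
    exact kappaConj_iteratedBracket hq l i j
  exact Module.End.mem_eigenspace_iff.mp (hle hY)

namespace IsGenericDatum

variable (h : IsGenericDatum C d q)
include h

lemma adE_iteratedBracket_mem (i : I) (l : List I) (j : I) (hl : wordWeight l j ≠ Pi.single i 1) :
    adE C d q i (iteratedBracket C d q l j) ∈
      wordSpace C d q (wordWeight l j - Pi.single i 1) := by
  have hq := h.generic.ne_zero
  induction l with
  | nil =>
    have hij : i ≠ j := by
      rintro rfl
      exact hl (wordWeight_nil i)
    rw [iteratedBracket, h.adE_xTildeMinus_of_ne hij]
    exact zero_mem _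
  | cons i' l ih =>
    have hFE : adF C d q i' (adE C d q i (iteratedBracket C d q l j)) ∈
        wordSpace C d q (wordWeight (i' :: l) j - Pi.single i 1) := by
      by_cases hw : wordWeight l j = Pi.single i 1
      · obtain ⟨rfl, rfl⟩ := wordWeight_eq_single_iff.mp hw
        rw [iteratedBracket, h.adE_xTildeMinus_self, map_smul, adF_phiTilde, wordWeight_cons, hw,
          add_sub_cancel_left, ← wordWeight_nil]
        exact Submodule.smul_mem _ _ (Submodule.smul_mem _ _ (iteratedBracket_mem_wordSpace [] i'))
      · rw [wordWeight_cons, ← sub_add_eq_add_sub]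
        exact adF_mem_wordSpace hq i' (ih hw)
    have hz := (h.generic_pow i).ne_zero
    rw [iteratedBracket_cons hq]
    obtain rfl | hii := eq_or_ne i i'
    · rw [← Submodule.smul_mem_iff _ (zpow_ne_zero (-2) hz),
        sub_eq_iff_eq_add.mp (h.smul_adE_adF_self_sub (kappaConj_iteratedBracket hq l i j))]
      refine add_mem (Submodule.smul_mem _ _ ?_) hFE
      rw [wordWeight_cons, add_sub_cancel_right]
      exact iteratedBracket_mem_wordSpace l j
    · rwa [← Submodule.smul_mem_iff _ (zpow_ne_zero (-C i i') hz), h.smul_adE_adF_of_ne hii]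

lemma adE_mem_wordSpace {i : I} {β : I → ℤ} (hβ : β ≠ Pi.single i 1) {Y : LoopAlgebra C d q}
    (hY : Y ∈ wordSpace C d q β) : adE C d q i Y ∈ wordSpace C d q (β - Pi.single i 1) := by
  have hle : wordSpace C d q β ≤ (wordSpace C d q (β - Pi.single i 1)).comap (adE C d q i) := by
    refine wordSpace_le_iff.mpr fun l j hl => ?_
    rw [Submodule.mem_comap, ← hl]
    exact h.adE_iteratedBracket_mem i l j (hl.trans_ne hβ)
  exact hle hY

lemma wordSpace_le_maxGenEigenspace_adF (i : I) (β : I → ℤ) :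
    wordSpace C d q β ≤ (adF C d q i).maxGenEigenspace 0 :=
  wordSpace_le_iff.mpr fun l j _ => h.iteratedBracket_mem_maxGenEigenspace_adF i l j

lemma isWeightString_wordSpace [Fintype I] {i : I} {β : I → ℤ}
    (hβ : β ∉ AddSubgroup.zmultiples (Pi.single i 1)) :
    IsWeightString (q ^ d i) (q ^ d i - (q ^ d i)⁻¹)⁻¹ (adE C d q i) (adF C d q i)
      (fun m => wordSpace C d q (β + m • Pi.single i 1)) (corootPairing C i β) where
  mapE {m y} hy := by
    rw [sub_smul, one_smul, ← add_sub_assoc]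
    refine h.adE_mem_wordSpace (fun hm => hβ ⟨1 - m, ?_⟩) hy
    rw [eq_sub_of_add_eq hm]
    simp [sub_smul]
  mapF {m y} hy := by
    rw [add_smul, one_smul, ← add_assoc]
    exact adF_mem_wordSpace h.generic.ne_zero i hy
  rel {m y} hy := by
    rw [h.smul_adE_adF_self_sub (kappaConj_of_mem_wordSpace h.generic.ne_zero i hy), map_add,
      map_smul, corootPairing_single, h.diag, smul_eq_mul, mul_comm m]

end IsGenericDatum

end WordSpaces

section RootSystems

variable {I : Type*} [DecidableEq I] {C : Matrix I I ℤ} {d : I → ℕ} {q : ℂ}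

lemma wordSpace_eq_bot_iff {β : I → ℤ} :
    wordSpace C d q β = ⊥ ↔ ∀ l j, wordWeight l j = β → iteratedBracket C d q l j = 0 := by
  simp only [← le_bot_iff, wordSpace_le_iff, Submodule.mem_bot]

lemma wordSpace_eq_bot_of_not_nonneg {β : I → ℤ} (hβ : ¬ 0 ≤ β) : wordSpace C d q β = ⊥ :=
  wordSpace_eq_bot_iff.mpr fun l j hl => absurd (hl ▸ (wordWeight_pos l j).le) hβ

lemma wordSpace_zero : wordSpace C d q 0 = ⊥ :=
  wordSpace_eq_bot_iff.mpr fun l j hl => absurd hl (wordWeight_pos l j).ne'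

lemma wordSpace_single (i : I) :
    wordSpace C d q (Pi.single i 1) = ℂ ∙ xTildeMinus C d q i 1 := by
  refine le_antisymm (wordSpace_le_iff.mpr fun l j hl => ?_) ?_
  · obtain ⟨rfl, rfl⟩ := wordWeight_eq_single_iff.mp hl
    exact Submodule.mem_span_singleton_self _
  · rw [Submodule.span_singleton_le_iff_mem, ← wordWeight_nil]
    exact iteratedBracket_mem_wordSpace [] i

lemma IsGenericDatum.adF_iteratedBracket_eq_zero (h : IsGenericDatum C d q) {i : I} (l : List I)
    {j : I} {m : ℤ} (hl : wordWeight l j = m • Pi.single i 1) :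
    adF C d q i (iteratedBracket C d q l j) = 0 := by
  induction l generalizing m with
  | nil =>
    obtain ⟨rfl, -⟩ := eq_and_eq_one_of_single_eq_smul_single (wordWeight_nil j ▸ hl)
    exact h.adF_xTildeMinus_self j
  | cons i' l ih =>
    obtain ⟨rfl, hl'⟩ := eq_and_eq_of_wordWeight_cons hl
    rw [iteratedBracket_cons h.generic.ne_zero, ih hl', map_zero]

lemma IsGenericDatum.wordSpace_smul_single (h : IsGenericDatum C d q) {i : I} {m : ℤ}
    (hm : m ≠ 1) : wordSpace C d q (m • Pi.single i 1) = ⊥ := by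
  refine wordSpace_eq_bot_iff.mpr fun l j hl => ?_
  cases l with
  | nil => exact absurd (eq_and_eq_one_of_single_eq_smul_single (wordWeight_nil j ▸ hl)).2 hm
  | cons i' l =>
    obtain ⟨rfl, hl'⟩ := eq_and_eq_of_wordWeight_cons hl
    rw [iteratedBracket_cons h.generic.ne_zero, h.adF_iteratedBracket_eq_zero l hl']

variable [Fintype I]

/-- The properties of the set of positive roots, in coordinates with respect to the simple roots,
that determine the weights of the iterated brackets. -/
structure IsPositiveRootSet (C : Matrix I I ℤ) (R : Set (I → ℤ)) : Prop where
  nonneg {β : I → ℤ} (hβ : β ∈ R) : 0 ≤ β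
  single_mem (i : I) : Pi.single i 1 ∈ R
  eq_one_of_smul_single_mem {i : I} {m : ℤ} (hm : m • Pi.single i 1 ∈ R) : m = 1
  zero_notMem : 0 ∉ R
  exists_corootPairing_pos {β : I → ℤ} (hβ : 0 ≤ β) (h0 : β ≠ 0) :
    ∃ i, 0 < β i ∧ 0 < corootPairing C i β
  string {β : I → ℤ} (hβ : β ∈ R) {i : I} (hi : β ∉ AddSubgroup.zmultiples (Pi.single i 1)) :
    ∃ p r : ℕ, (p : ℤ) - r = corootPairing C i β ∧
      ∀ m : ℤ, β + m • Pi.single i 1 ∈ R ↔ -(p : ℤ) ≤ m ∧ m ≤ r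

namespace IsPositiveRootSet

variable {R : Set (I → ℤ)} (hR : IsPositiveRootSet C R)
include hR

lemma eq_single_of_mem_zmultiples {β : I → ℤ} (hβ : β ∈ R) {i : I}
    (hi : β ∈ AddSubgroup.zmultiples (Pi.single i 1)) : β = Pi.single i 1 := by
  obtain ⟨m, rfl : m • Pi.single i 1 = β⟩ := hi
  rw [hR.eq_one_of_smul_single_mem hβ, one_smul]

lemma add_smul_single_notMem {i : I} (hC : C i i = 2) {β : I → ℤ} (hβ : β ∉ R)
    (hi : β ∉ AddSubgroup.zmultiples (Pi.single i 1)) {m : ℤ} (hm : m ≤ -corootPairing C i β)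
    (h0 : m ≤ 0) : β + m • Pi.single i 1 ∉ R := by
  intro hmem
  have hi' : β + m • Pi.single i 1 ∉ AddSubgroup.zmultiples (Pi.single i 1) :=
    fun hmul => hi ((add_mem_cancel_right (AddSubgroup.zsmul_mem_zmultiples _ m)).mp hmul)
  obtain ⟨p, r, hpr, hiff⟩ := hR.string hmem hi'
  rw [map_add, map_zsmul, corootPairing_single, hC, smul_eq_mul] at hpr
  have hback := (hiff (-m)).mpr ⟨by omega, by omega⟩
  rw [neg_smul, add_neg_cancel_right] at hback
  exact hβ hback

lemma add_single_mem {i : I} {β : I → ℤ} (hβ : β ∈ R) (hC : 0 ≤ C i i)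
    (hneg : corootPairing C i β < 0) : β + Pi.single i 1 ∈ R := by
  have hi : β ∉ AddSubgroup.zmultiples (Pi.single i 1) := by
    intro hi
    rw [hR.eq_single_of_mem_zmultiples hβ hi, corootPairing_single] at hneg
    omega
  obtain ⟨p, r, hpr, hiff⟩ := hR.string hβ hi
  simpa using (hiff 1).mpr ⟨by omega, by omega⟩

lemma sub_single_mem {i : I} {β : I → ℤ} (hβ : β ∈ R)
    (hi : β ∉ AddSubgroup.zmultiples (Pi.single i 1)) (hpos : 0 < corootPairing C i β) :
    β - Pi.single i 1 ∈ R := by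
  obtain ⟨p, r, hpr, hiff⟩ := hR.string hβ hi
  simpa [sub_eq_add_neg] using (hiff (-1)).mpr ⟨by omega, by omega⟩

lemma exists_add_single_mem (hC : ∀ i, C i i = 2) {β γ : I → ℤ} (hβ : β ∈ R) (hγ : γ ∈ R)
    (hlt : β < γ) : ∃ i, β + Pi.single i 1 ∈ R := by
  have hfin : {δ ∈ R | β < δ ∧ δ ≤ γ}.Finite :=
    (Set.finite_Icc β γ).subset fun δ hδ => ⟨hδ.2.1.le, hδ.2.2⟩
  obtain ⟨δ, ⟨hδ, hβδ, hδγ⟩, hmin⟩ := hfin.exists_minimal ⟨γ, hγ, hlt, le_rfl⟩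
  obtain ⟨i, hi, hpair⟩ := hR.exists_corootPairing_pos (sub_nonneg.mpr hβδ.le)
    (sub_ne_zero.mpr hβδ.ne')
  refine ⟨i, ?_⟩
  rw [map_sub, sub_pos] at hpair
  obtain hneg | hpos : corootPairing C i β < 0 ∨ 0 < corootPairing C i δ := by omega
  · exact hR.add_single_mem hβ (by rw [hC]; decide) hneg
  have hβ' : β ≤ δ - Pi.single i 1 := by
    intro j
    obtain rfl | hj := eq_or_ne j i
    · simp only [Pi.sub_apply, Pi.single_eq_same] at hi ⊢
      omega
    · simpa [hj] using hβδ.le j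
  have hmul : δ ∉ AddSubgroup.zmultiples (Pi.single i 1) := by
    intro hmul
    rw [hR.eq_single_of_mem_zmultiples hδ hmul, sub_self] at hβ'
    exact hR.zero_notMem (le_antisymm hβ' (hR.nonneg hβ) ▸ hβ)
  have hmem := hR.sub_single_mem hδ hmul hpos
  obtain heq | hlt' := hβ'.eq_or_lt
  · rwa [heq, sub_add_cancel]
  · have hle := hmin ⟨hmem, hlt', (sub_le_self _ (Pi.single_nonneg.mpr zero_le_one)).trans hδγ⟩
      (sub_le_self _ (Pi.single_nonneg.mpr zero_le_one))
    exact absurd (hle i) (by simp)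

end IsPositiveRootSet

namespace IsGenericDatum

variable (h : IsGenericDatum C d q) {R : Set (I → ℤ)} (hR : IsPositiveRootSet C R)
include h hR

lemma wordSpace_eq_bot_of_lower {i : I} {β : I → ℤ} (hβ : β ∉ R)
    (hi : β ∉ AddSubgroup.zmultiples (Pi.single i 1)) (hpos : 0 < corootPairing C i β)
    (hlow : ∀ m < (0 : ℤ), β + m • Pi.single i 1 ∉ R →
      wordSpace C d q (β + m • Pi.single i 1) = ⊥) :
    wordSpace C d q β = ⊥ := by
  have hbot : ∀ m < 1 - corootPairing C i β, wordSpace C d q (β + m • Pi.single i 1) = ⊥ :=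
    fun m hm => hlow m (by omega)
      (hR.add_smul_single_notMem (h.diag i) hβ hi (by omega) (by omega))
  simpa using (h.isWeightString_wordSpace hi).eq_bot_of_lt
    (fun _ => h.wordSpace_le_maxGenEigenspace_adF i _) hbot (h.generic_pow i)
    (inv_ne_zero (h.generic_pow i).sub_inv_ne_zero) (k := 0) (by omega)

lemma finrank_wordSpace_of_lower {i : I} {β : I → ℤ} (hβ : β ∈ R)
    (hi : β ∉ AddSubgroup.zmultiples (Pi.single i 1)) (hpos : 0 < corootPairing C i β)
    (hlow : ∀ m < (0 : ℤ),
      (β + m • Pi.single i 1 ∉ R → wordSpace C d q (β + m • Pi.single i 1) = ⊥) ∧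
      (β + m • Pi.single i 1 ∈ R →
        Module.finrank ℂ (wordSpace C d q (β + m • Pi.single i 1)) = 1)) :
    Module.finrank ℂ (wordSpace C d q β) = 1 := by
  obtain ⟨p, r, hpr, hiff⟩ := hR.string hβ hi
  have hbot : ∀ m < -(p : ℤ), wordSpace C d q (β + m • Pi.single i 1) = ⊥ :=
    fun m hm => (hlow m (by omega)).1 fun hmem => by have := (hiff m).mp hmem; omega
  have hone {m : ℤ} (hm : -(p : ℤ) ≤ m) (h0 : m < 0) :
      Module.finrank ℂ (wordSpace C d q (β + m • Pi.single i 1)) = 1 :=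
    (hlow m h0).2 ((hiff m).mpr ⟨hm, by omega⟩)
  have hrank := (h.isWeightString_wordSpace hi).finrank_eq_one
    (fun _ => h.wordSpace_le_maxGenEigenspace_adF i _) hbot (h.generic_pow i)
    (inv_ne_zero (h.generic_pow i).sub_inv_ne_zero) (k := 0) (by omega) (by omega) (by omega)
    (Submodule.nontrivial_iff_ne_bot.mp
      (Module.nontrivial_of_finrank_eq_succ (hone le_rfl (by omega))))
    (hone (by omega) (by omega))
  rwa [zero_smul, add_zero] at hrank

variable (hx : ∀ j, xTildeMinus C d q j 1 ≠ 0)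
include hx

lemma wordSpace_dichotomy (β : I → ℤ) : (β ∉ R → wordSpace C d q β = ⊥) ∧
    (β ∈ R → Module.finrank ℂ (wordSpace C d q β) = 1) := by
  induction hn : (∑ j, β j).toNat using Nat.strong_induction_on generalizing β with
  | _ n ih =>
  by_cases hβ : 0 ≤ β
  swap
  · exact ⟨fun _ => wordSpace_eq_bot_of_not_nonneg hβ, fun hmem => absurd (hR.nonneg hmem) hβ⟩
  obtain rfl | h0 := eq_or_ne β 0
  · exact ⟨fun _ => wordSpace_zero, fun hmem => absurd hmem hR.zero_notMem⟩
  obtain ⟨i, hi, hpos⟩ := hR.exists_corootPairing_pos hβ h0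
  by_cases hmul : β ∈ AddSubgroup.zmultiples (Pi.single i 1)
  · obtain ⟨m, rfl : m • Pi.single i 1 = β⟩ := hmul
    refine ⟨fun hmem => h.wordSpace_smul_single ?_, fun hmem => ?_⟩
    · rintro rfl
      exact hmem (by simpa using hR.single_mem i)
    · rw [hR.eq_one_of_smul_single_mem hmem, one_smul, wordSpace_single,
        finrank_span_singleton (hx i)]
  · have hsum : 0 < ∑ j, β j := Finset.sum_pos' (fun j _ => hβ j) ⟨i, Finset.mem_univ i, hi⟩
    have hlow (m : ℤ) (hm : m < 0) := ih _ (by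
      simp only [Pi.add_apply, Pi.smul_apply, smul_eq_mul, Finset.sum_add_distrib,
        ← Finset.mul_sum, Finset.sum_pi_single', Finset.mem_univ, if_true]
      omega) (β + m • Pi.single i 1) rfl
    exact ⟨fun hmem => h.wordSpace_eq_bot_of_lower hR hmem hmul hpos fun m hm => (hlow m hm).1,
      fun hmem => h.finrank_wordSpace_of_lower hR hmem hmul hpos hlow⟩

lemma map_wordSpace {β : I → ℤ} {i : I} (hβ : β ∈ R) (hβi : β + Pi.single i 1 ∈ R) :
    (wordSpace C d q β).map (adF C d q i) = wordSpace C d q (β + Pi.single i 1) ∧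
      (wordSpace C d q (β + Pi.single i 1)).map (adE C d q i) = wordSpace C d q β := by
  have hdich := h.wordSpace_dichotomy hR hx
  have hmul : β ∉ AddSubgroup.zmultiples (Pi.single i 1) := by
    intro hmul
    rw [hR.eq_single_of_mem_zmultiples hβ hmul, ← two_zsmul] at hβi
    exact absurd (hR.eq_one_of_smul_single_mem hβi) (by decide)
  obtain ⟨p, r, hpr, hiff⟩ := hR.string hβ hmul
  have hr : 1 ≤ (r : ℤ) := ((hiff 1).mp (by rwa [one_smul])).2
  have hbot : ∀ m < -(p : ℤ), wordSpace C d q (β + m • Pi.single i 1) = ⊥ :=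
    fun m hm => (hdich _).1 fun hmem => by have := (hiff m).mp hmem; omega
  have hone {m : ℤ} (hm : -(p : ℤ) ≤ m) (hmr : m ≤ r) :
      Module.finrank ℂ (wordSpace C d q (β + m • Pi.single i 1)) = 1 :=
    (hdich _).2 ((hiff m).mpr ⟨hm, hmr⟩)
  simpa using (h.isWeightString_wordSpace hmul).map_F_eq_and_map_E_eq
    (fun _ => h.wordSpace_le_maxGenEigenspace_adF i _) hbot (h.generic_pow i)
    (inv_ne_zero (h.generic_pow i).sub_inv_ne_zero) (k := 0) (by omega) (by omega)
    (Submodule.nontrivial_iff_ne_bot.mp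
      (Module.nontrivial_of_finrank_eq_succ (hone le_rfl (by omega))))
    (hone (by omega) (by omega)) (hone (by omega) (by omega))

end IsGenericDatum

end RootSystems

section Borel

/-- Indecomposability of a generalized Cartan matrix: a non-empty set of indices which is closed
under adjacency in the Dynkin diagram contains all indices. -/
def IsIndecomposable {I : Type*} (C : Matrix I I ℤ) : Prop :=
  ∀ s : Set I, s.Nonempty → (∀ i ∈ s, ∀ j, C i j ≠ 0 → j ∈ s) → s = Set.univ

variable {I : Type*} {C : Matrix I I ℤ} {d : I → ℕ} {q : ℂ} {l : List I} {j₀ : I}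

lemma xPlus_zero_mem_borel (i : I) : xPlus C d q i 0 ∈ borel C d q l j₀ :=
  Algebra.subset_adjoin (Or.inl (Or.inl (Or.inl ⟨i, rfl⟩)))

lemma k_mem_borel (i : I) : k C d q i ∈ borel C d q l j₀ :=
  Algebra.subset_adjoin (Or.inl (Or.inl (Or.inr ⟨i, rfl⟩)))

lemma kInv_mem_borel (i : I) : kInv C d q i ∈ borel C d q l j₀ :=
  Algebra.subset_adjoin (Or.inl (Or.inr ⟨i, rfl⟩))

lemma iteratedBracket_mem_borel : iteratedBracket C d q l j₀ ∈ borel C d q l j₀ :=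
  Algebra.subset_adjoin (Or.inr rfl)

lemma adE_mem_borel (i : I) {Y : LoopAlgebra C d q} (hY : Y ∈ borel C d q l j₀) :
    adE C d q i Y ∈ borel C d q l j₀ := by
  rw [adE, skewAd_apply, kappaConj_apply]
  exact sub_mem (mul_mem (xPlus_zero_mem_borel i) hY)
    (mul_mem (mul_mem (mul_mem (kInv_mem_borel i) hY) (k_mem_borel i)) (xPlus_zero_mem_borel i))

lemma mem_borel_of_smul_mem {c : ℂ} (hc : c ≠ 0) {Y : LoopAlgebra C d q}
    (hY : c • Y ∈ borel C d q l j₀) : Y ∈ borel C d q l j₀ :=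
  ((borel C d q l j₀).toSubmodule.smul_mem_iff hc).mp hY

namespace IsGenericDatum

variable (h : IsGenericDatum C d q)
include h

lemma adE_xTildeMinus_coeff_ne_zero (i : I) :
    (q ^ d i) ^ C i i * (q ^ d i - (q ^ d i)⁻¹)⁻¹ ≠ 0 :=
  mul_ne_zero (zpow_ne_zero _ (h.generic_pow i).ne_zero)
    (inv_ne_zero (h.generic_pow i).sub_inv_ne_zero)

lemma xTildeMinus_one_eq_zero (hC : IsIndecomposable C) {i : I}
    (hi : xTildeMinus C d q i 1 = 0) (j : I) : xTildeMinus C d q j 1 = 0 := by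
  refine (hC {i | xTildeMinus C d q i 1 = 0} ⟨i, hi⟩ fun i hi j hij => ?_).ge (Set.mem_univ j)
  have hφ : phiTilde C d q i 1 = 0 := by
    have hE := h.adE_xTildeMinus_self i
    rwa [hi, map_zero, eq_comm, smul_eq_zero_iff_right (h.adE_xTildeMinus_coeff_ne_zero i)] at hE
  have hF := adF_phiTilde (C := C) (d := d) (q := q) i j
  rwa [hφ, map_zero, eq_comm, smul_eq_zero_iff_right
    ((h.generic_pow i).zpow_sub_zpow_ne_zero (by omega))] at hF

section Descent

variable [Fintype I] [DecidableEq I] {R : Set (I → ℤ)} (hR : IsPositiveRootSet C R)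
  (hl : ∀ l', l' <:+ l → wordWeight l' j₀ ∈ R)
include hR hl

lemma wordSpace_wordWeight (hx : ∀ j, xTildeMinus C d q j 1 ≠ 0) :
    wordSpace C d q (wordWeight l j₀) = ℂ ∙ iteratedBracket C d q l j₀ := by
  induction l with
  | nil =>
    rw [wordWeight_nil]
    exact wordSpace_single j₀
  | cons i l ih =>
    rw [wordWeight_cons, iteratedBracket_cons h.generic.ne_zero,
      ← (h.map_wordSpace hR hx (hl l (List.suffix_cons i l))
        (wordWeight_cons i l j₀ ▸ hl _ List.suffix_rfl)).1,
      ih fun l' hl' => hl l' (hl'.trans (List.suffix_cons i l)), Submodule.map_span,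
      Set.image_singleton]

variable (hmax : ∀ β ∈ R, β ≤ wordWeight l j₀)
include hmax

/-- Descending induction on the root, starting from the highest one, where the word space is
spanned by the generator `e_0`. -/
lemma wordSpace_le_borel (hx : ∀ j, xTildeMinus C d q j 1 ≠ 0) {β : I → ℤ} (hβ : β ∈ R) :
    wordSpace C d q β ≤ (borel C d q l j₀).toSubmodule := by
  by_contra hnot
  have hfin : {β ∈ R | ¬ wordSpace C d q β ≤ (borel C d q l j₀).toSubmodule}.Finite :=
    (Set.finite_Icc 0 (wordWeight l j₀)).subset fun γ hγ => ⟨hR.nonneg hγ.1, hmax γ hγ.1⟩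
  obtain ⟨γ, ⟨hγ, hγnot⟩, hγmax⟩ := hfin.exists_maximal ⟨β, hβ, hnot⟩
  have hlt : γ < wordWeight l j₀ := by
    refine lt_of_le_of_ne (hmax γ hγ) fun heq => hγnot ?_
    rw [heq, h.wordSpace_wordWeight hR hl hx, Submodule.span_singleton_le_iff_mem]
    exact iteratedBracket_mem_borel
  obtain ⟨i, hi⟩ := hR.exists_add_single_mem h.diag hγ (hl l List.suffix_rfl) hlt
  have hle : wordSpace C d q (γ + Pi.single i 1) ≤ (borel C d q l j₀).toSubmodule := by
    by_contra hnot'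
    have hback := hγmax ⟨hi, hnot'⟩ (le_add_of_nonneg_right (Pi.single_nonneg.mpr zero_le_one)) i
    exact absurd hback (by simp)
  refine hγnot ?_
  rw [← (h.map_wordSpace hR hx hγ hi).2, Submodule.map_le_iff_le_comap]
  exact fun Y hY => adE_mem_borel i (hle hY)

lemma xTildeMinus_one_mem_borel (hC : IsIndecomposable C) (i : I) :
    xTildeMinus C d q i 1 ∈ borel C d q l j₀ := by
  by_cases hx : ∀ j, xTildeMinus C d q j 1 ≠ 0
  · have hle := h.wordSpace_le_borel hR hl hmax hx (hR.single_mem i)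
    rwa [wordSpace_single, Submodule.span_singleton_le_iff_mem] at hle
  · obtain ⟨j, hj⟩ := not_forall_not.mp hx
    rw [h.xTildeMinus_one_eq_zero hC hj i]
    exact zero_mem _

end Descent

variable (hx : ∀ i, xTildeMinus C d q i 1 ∈ borel C d q l j₀)
include hx

lemma phiTilde_one_mem_borel (i : I) : phiTilde C d q i 1 ∈ borel C d q l j₀ := by
  have hE := adE_mem_borel i (hx i)
  rw [h.adE_xTildeMinus_self] at hE
  exact mem_borel_of_smul_mem (h.adE_xTildeMinus_coeff_ne_zero i) hE

lemma xPlus_mem_borel (i : I) (r : ℕ) : xPlus C d q i r ∈ borel C d q l j₀ := by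
  have hφ := h.phiTilde_one_mem_borel hx i
  induction r with
  | zero => exact xPlus_zero_mem_borel i
  | succ r ih =>
    have hcomm := sub_mem (mul_mem hφ ih) (mul_mem ih hφ)
    rw [phiTilde_one_mul_xPlus, add_sub_cancel_left] at hcomm
    exact mod_cast mem_borel_of_smul_mem
      ((h.generic_pow i).zpow_sub_zpow_ne_zero (by rw [h.diag]; decide)) hcomm

lemma xTildeMinus_mem_borel (i : I) (r : ℕ) : xTildeMinus C d q i (r + 1) ∈ borel C d q l j₀ := by
  have hφ := h.phiTilde_one_mem_borel hx i
  induction r with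
  | zero => simpa using hx i
  | succ r ih =>
    have hcomm := sub_mem (mul_mem hφ ih) (mul_mem ih hφ)
    rw [phiTilde_one_mul_xTildeMinus, add_sub_cancel_left] at hcomm
    exact mod_cast mem_borel_of_smul_mem
      ((h.generic_pow i).zpow_sub_zpow_ne_zero (by rw [h.diag]; decide)) hcomm

lemma phiTilde_mem_borel (i : I) (m : ℕ) : phiTilde C d q i m ∈ borel C d q l j₀ := by
  cases m with
  | zero =>
    rw [phiTilde_zero]
    exact one_mem _
  | succ m =>
    have hp := h.xPlus_mem_borel hx i m
    have hcomm := sub_mem (Subalgebra.smul_mem _ (mul_mem hp (hx i)) ((q ^ d i) ^ (-C i i)))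
      (mul_mem (hx i) hp)
    rw [smul_xPlus_mul_xTildeMinus_sub i (by omega)] at hcomm
    exact mem_borel_of_smul_mem (inv_ne_zero (h.generic_pow i).sub_inv_ne_zero) hcomm

lemma phiPlus_mem_borel (i : I) (m : ℕ) : phiPlus C d q i m ∈ borel C d q l j₀ := by
  rw [phiPlus_eq]
  exact mul_mem (k_mem_borel i) (h.phiTilde_mem_borel hx i m)

end IsGenericDatum

end Borel

section RootPairings

variable {ι M N : Type*} [AddCommGroup M] [Module ℂ M] [AddCommGroup N] [Module ℂ N]
  {P : RootPairing ι ℂ M N}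

/-- The element `∑ β_j α_j` of the root lattice with coordinates `β`. -/
def rootCombination (b : P.Base) : (b.support → ℤ) →ₗ[ℤ] M :=
  Fintype.linearCombination ℤ fun j : b.support => P.root j

lemma rootCombination_apply (b : P.Base) (β : b.support → ℤ) :
    rootCombination b β = ∑ j, β j • P.root j :=
  Fintype.linearCombination_apply ..

lemma rootCombination_single [DecidableEq ι] (b : P.Base) (i : b.support) :
    rootCombination b (Pi.single i 1) = P.root i := by
  rw [rootCombination, Fintype.linearCombination_apply_single, one_smul]

lemma rootCombination_injective (b : P.Base) : Function.Injective (rootCombination b) :=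
  (b.linearIndepOn_root.restrict_scalars' ℤ).fintypeLinearCombination_injective

lemma nonneg_of_rootCombination_mem_closure {b : P.Base} {β : b.support → ℤ}
    (hβ : rootCombination b β ∈ AddSubmonoid.closure (P.root '' b.support)) : 0 ≤ β := by
  classical
  have hle : AddSubmonoid.closure (P.root '' b.support) ≤
      (AddSubmonoid.nonneg (b.support → ℤ)).map (rootCombination b) := by
    rw [AddSubmonoid.closure_le]
    rintro _ ⟨i, hi, rfl⟩
    exact ⟨Pi.single ⟨i, hi⟩ 1, Pi.single_nonneg.mpr zero_le_one, rootCombination_single b ⟨i, hi⟩⟩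
  obtain ⟨γ, hγ, heq⟩ := hle hβ
  rwa [← rootCombination_injective b heq]

lemma rootCombination_wordWeight [DecidableEq ι] (b : P.Base) (l : List b.support)
    (j₀ : b.support) : rootCombination b (wordWeight l j₀) = wordRoot b l j₀ := by
  induction l with
  | nil => simp [wordWeight_nil, wordRoot, rootCombination_single]
  | cons i l ih =>
    rw [wordWeight_cons, map_add, ih, rootCombination_single]
    simp only [wordRoot, List.bind_eq_flatMap, List.pure_def, List.flatMap_cons, List.map_append,
      List.map_cons, List.map_nil, List.sum_append, List.sum_cons, List.sum_nil]
    abel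

lemma corootPairing_eq_pairingIn [P.IsCrystallographic] (b : P.Base) (i : b.support)
    {β : b.support → ℤ} {a : ι} (ha : P.root a = rootCombination b β) :
    corootPairing b.cartanMatrix.transpose i β = P.pairingIn ℤ a i := by
  apply (algebraMap ℤ ℂ).injective_int
  rw [P.algebraMap_pairingIn ℤ, ← P.root_coroot'_eq_pairing, ha, rootCombination_apply, map_sum]
  simp only [corootPairing, LinearMap.comp_apply, Matrix.mulVecLin_apply, LinearMap.proj_apply,
    Matrix.mulVec, dotProduct, map_sum, map_mul, Matrix.transpose_apply, map_zsmul,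
    RootPairing.root_coroot'_eq_pairing, RootPairing.Base.algebraMap_cartanMatrixIn_apply]
  refine Finset.sum_congr rfl fun j _ => ?_
  rw [zsmul_eq_mul, mul_comm, eq_intCast]

lemma dotProduct_cartanMatrix_mul_diagonal_mulVec [DecidableEq ι] [P.IsCrystallographic]
    (b : P.Base) (D β : b.support → ℤ) :
    β ⬝ᵥ (b.cartanMatrix * Matrix.diagonal D).mulVec β =
      ∑ i, D i * (β i * corootPairing b.cartanMatrix.transpose i β) := by
  rw [Matrix.dotProduct_mulVec, ← Matrix.vecMul_vecMul]
  refine Finset.sum_congr rfl fun i _ => ?_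
  rw [Matrix.vecMul_diagonal, corootPairing, LinearMap.comp_apply, Matrix.mulVecLin_apply,
    Matrix.mulVec_transpose, LinearMap.proj_apply]
  ring

/-- The symmetrized Cartan matrix is positive definite. -/
lemma exists_corootPairing_cartanMatrix_pos [Finite ι] [P.IsRootSystem] [P.IsCrystallographic]
    (b : P.Base) {β : b.support → ℤ} (hβ : 0 ≤ β) (h0 : β ≠ 0) :
    ∃ i, 0 < β i ∧ 0 < corootPairing b.cartanMatrix.transpose i β := by
  classical
  obtain ⟨D, hD, hdef⟩ := b.exists_cartanMatrix_mul_diagaonal_posDef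
  have hsum := hdef.dotProduct_mulVec_pos h0
  rw [star_trivial, dotProduct_cartanMatrix_mul_diagonal_mulVec] at hsum
  obtain ⟨i, -, hi⟩ := Finset.exists_lt_of_sum_lt (Finset.sum_const_zero.trans_lt hsum)
  have hprod := pos_of_mul_pos_right hi (hD i).le
  exact ⟨i, (hβ i).lt_of_ne' (left_ne_zero_of_mul hprod.ne'), pos_of_mul_pos_right hprod (hβ i)⟩

/-- The coordinates of the positive roots with respect to the simple roots. -/
def positiveRootCoordinates (b : P.Base) : Set (b.support → ℤ) :=
  {β | 0 ≤ β ∧ rootCombination b β ∈ Set.range P.root}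

lemma nonneg_or_nonpos_of_rootCombination_mem {b : P.Base} {β : b.support → ℤ}
    (hβ : rootCombination b β ∈ Set.range P.root) : 0 ≤ β ∨ β ≤ 0 := by
  obtain ⟨a, ha⟩ := hβ
  obtain hpos | hneg := b.root_mem_or_neg_mem a
  · exact Or.inl (nonneg_of_rootCombination_mem_closure (ha ▸ hpos))
  · rw [ha, ← map_neg] at hneg
    exact Or.inr (neg_nonneg.mp (nonneg_of_rootCombination_mem_closure hneg))

lemma add_smul_single_nonneg_of_rootCombination_mem [DecidableEq ι] {b : P.Base}
    {β : b.support → ℤ} (hβ : 0 ≤ β) {i : b.support}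
    (hi : β ∉ AddSubgroup.zmultiples (Pi.single i 1)) {m : ℤ}
    (hm : rootCombination b (β + m • Pi.single i 1) ∈ Set.range P.root) :
    0 ≤ β + m • Pi.single i 1 := by
  refine (nonneg_or_nonpos_of_rootCombination_mem hm).resolve_right fun hnonpos => hi ?_
  refine AddSubgroup.mem_zmultiples_iff.mpr ⟨β i, funext fun j => ?_⟩
  obtain rfl | hj := eq_or_ne j i
  · simp
  · have hle := hnonpos j
    simp only [Pi.add_apply, Pi.smul_apply, Pi.single_eq_of_ne hj, smul_zero, add_zero] at hle ⊢
    exact le_antisymm (hβ j) hle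

lemma eq_one_of_smul_single_mem_positiveRootCoordinates [DecidableEq ι] [P.IsRootSystem]
    [P.IsCrystallographic] [P.IsReduced] [Finite ι] {b : P.Base} {i : b.support} {m : ℤ}
    (hm : m • Pi.single i 1 ∈ positiveRootCoordinates b) : m = 1 := by
  have : Module.IsReflexive ℂ M := .of_isPerfPair P.toLinearMap
  have : Module.IsReflexive ℂ N := .of_isPerfPair P.flip.toLinearMap
  have : IsAddTorsionFree M := .of_isTorsionFree ℂ M
  have : IsAddTorsionFree N := .of_isTorsionFree ℂ N
  obtain ⟨hnonneg, hroot⟩ := hm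
  rw [map_zsmul, rootCombination_single, ← Int.cast_smul_eq_zsmul ℂ] at hroot
  have hsign := b.eq_one_or_neg_one_of_mem_support_of_smul_mem i i.2 m hroot
  have hpos : 0 ≤ m := by simpa using hnonneg i
  norm_cast at hsign
  omega

lemma linearIndependent_root_pair [DecidableEq ι] [P.IsReduced] {b : P.Base} {a : ι}
    {β : b.support → ℤ} (ha : P.root a = rootCombination b β) {i : b.support}
    (hi : β ∉ AddSubgroup.zmultiples (Pi.single i 1)) :
    LinearIndependent ℂ ![P.root i, P.root a] := by
  have hne (m : ℤ) : P.root a ≠ m • P.root i := fun heq => hi <| by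
    rw [ha, ← rootCombination_single, ← map_zsmul] at heq
    exact ⟨m, (rootCombination_injective b heq).symm⟩
  exact RootPairing.IsReduced.linearIndependent P
    (fun heq => hne 1 (by rw [one_smul, heq])) (fun heq => hne (-1) (by simp [heq]))

lemma isPositiveRootSet_positiveRootCoordinates [Finite ι] [DecidableEq ι] [P.IsRootSystem]
    [P.IsCrystallographic] [P.IsReduced] (b : P.Base) :
    IsPositiveRootSet b.cartanMatrix.transpose (positiveRootCoordinates b) where
  nonneg hβ := hβ.1
  single_mem i := ⟨Pi.single_nonneg.mpr zero_le_one, i, (rootCombination_single b i).symm⟩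
  eq_one_of_smul_single_mem := eq_one_of_smul_single_mem_positiveRootCoordinates
  zero_notMem := by
    rintro ⟨-, a, ha⟩
    exact P.ne_zero a (by rw [ha, map_zero])
  exists_corootPairing_pos := exists_corootPairing_cartanMatrix_pos b
  string {β} hβ i hi := by
    obtain ⟨hnonneg, a, ha⟩ := hβ
    have hlin := linearIndependent_root_pair ha hi
    refine ⟨P.chainBotCoeff i a, P.chainTopCoeff i a, ?_, fun m => ?_⟩
    · rw [corootPairing_eq_pairingIn b i ha, P.chainBotCoeff_sub_chainTopCoeff hlin]
    · rw [← Set.mem_Icc, ← P.root_add_zsmul_mem_range_iff hlin, ha, ← rootCombination_single,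
        ← map_zsmul, ← map_add]
      exact ⟨And.right,
        fun hm => ⟨add_smul_single_nonneg_of_rootCombination_mem hnonneg hi hm, hm⟩⟩

lemma isGenericDatum_cartanMatrix [Finite ι] [P.IsCrystallographic] (b : P.Base)
    {d : b.support → ℕ} (hd : IsSymmetrizer b.cartanMatrix.transpose d) {q : ℂˣ}
    (hq : ∀ n : ℕ, 0 < n → q ^ n ≠ 1) : IsGenericDatum b.cartanMatrix.transpose d (q : ℂ) where
  generic := ⟨q.ne_zero, fun n hn h1 => hq n hn (Units.ext (by simpa using h1))⟩
  pos := hd.pos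
  symm := hd.symm
  diag i := b.cartanMatrix_apply_same i
  nonpos {i j} hij := b.cartanMatrix_le_zero_of_ne j i hij.symm

lemma isIndecomposable_cartanMatrix_transpose [Finite ι] [P.IsCrystallographic]
    [P.IsReduced] [P.IsIrreducible] (b : P.Base) : IsIndecomposable b.cartanMatrix.transpose :=
  fun s ⟨_, hi⟩ hs => Set.eq_univ_of_forall fun _ =>
    b.induction_on_cartanMatrix (· ∈ s) hi fun i j hi' hij => hs i hi' j hij

lemma IsMaximalRootWord.xTildeMinus_one_mem_borel [Finite ι] [P.IsRootSystem]
    [P.IsCrystallographic] [P.IsReduced] [P.IsIrreducible] {b : P.Base}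
    {l : List b.support} {j₀ : b.support} (hl : IsMaximalRootWord b l j₀)
    {d : b.support → ℕ} {q : ℂ} (h : IsGenericDatum b.cartanMatrix.transpose d q)
    (i : b.support) :
    xTildeMinus b.cartanMatrix.transpose d q i 1 ∈ borel b.cartanMatrix.transpose d q l j₀ := by
  classical
  refine h.xTildeMinus_one_mem_borel (isPositiveRootSet_positiveRootCoordinates b)
    (fun l' hl' => ⟨(wordWeight_pos l' j₀).le, ?_⟩) ?_ (isIndecomposable_cartanMatrix_transpose b) i
  · rw [rootCombination_wordWeight]
    exact hl.isRoot l' hl'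
  · rintro β ⟨-, a, ha⟩
    have hsub := hl.highest a
    rw [← rootCombination_wordWeight, ha, ← map_sub] at hsub
    exact sub_nonneg.mp (nonneg_of_rootCombination_mem_closure hsub)

end RootPairings

section Recurrence

lemma isRational_of_coeff_mul_eq_zero {f : PowerSeries ℂ} {Q : Polynomial ℂ} (hQ : Q ≠ 0) {n : ℕ}
    (h : ∀ m ≥ n, PowerSeries.coeff m ((Q : PowerSeries ℂ) * f) = 0) : IsRational f := by
  refine ⟨PowerSeries.trunc n (Q * f), Q, hQ, ?_⟩
  ext m
  rw [Polynomial.coeff_coe, PowerSeries.coeff_trunc]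
  split_ifs with hm
  · rfl
  · exact h m (not_lt.mp hm)

lemma isRational_of_recurrence {f : PowerSeries ℂ} {c : ℕ →₀ ℂ} (hc : c ≠ 0) {N : ℕ}
    (h : ∀ s ≥ N, (c.sum fun r a => a * PowerSeries.coeff (s + r) f) = 0) : IsRational f := by
  obtain ⟨n, hn⟩ : ∃ n, ∀ r ∈ c.support, r ≤ n :=
    ⟨c.support.sup id, fun r hr => Finset.le_sup (f := id) hr⟩
  refine isRational_of_coeff_mul_eq_zero
    (Q := ∑ r ∈ c.support, Polynomial.monomial (n - r) (c r)) ?_ (n := N + n) fun m hm => ?_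
  · obtain ⟨r, hr⟩ := Finsupp.support_nonempty_iff.mpr hc
    refine fun hzero => Finsupp.mem_support_iff.mp hr ?_
    have hcoeff := congrArg (Polynomial.coeff · (n - r)) hzero
    simp only [Polynomial.finsetSum_coeff, Polynomial.coeff_monomial,
      Polynomial.coeff_zero] at hcoeff
    rwa [Finset.sum_eq_single_of_mem r hr, if_pos rfl] at hcoeff
    intro r' hr' hne
    have := hn r hr
    have := hn r' hr'
    rw [if_neg (by omega)]
  · obtain ⟨s, rfl⟩ := Nat.exists_eq_add_of_le' (Nat.le_of_add_left_le hm)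
    rw [← h s (by omega), Finsupp.sum, ← Polynomial.coeToPowerSeries.ringHom_apply, map_sum,
      Finset.sum_mul, map_sum]
    refine Finset.sum_congr rfl fun r hr => ?_
    have := hn r hr
    rw [Polynomial.coeToPowerSeries.ringHom_apply, Polynomial.coe_monomial,
      PowerSeries.monomial_eq_C_mul_X_pow, mul_assoc, PowerSeries.coeff_C_mul,
      show s + n = (s + r) + (n - r) by omega, PowerSeries.coeff_X_pow_mul]

end Recurrence

section LinearAlgebra

lemma exists_ne_zero_forall_apply_eq_zero {R V J : Type*} [Semiring R] [AddCommMonoid V]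
    [Module R V] {T : J → Module.End R V} (hT : ∀ i j, Commute (T i) (T j)) {v : V} (hv : v ≠ 0)
    {p : ℕ} (hp : ∀ j, (T j ^ p) v = 0) (S : Finset J) :
    ∃ w, w ≠ 0 ∧ (∀ j, (T j ^ p) w = 0) ∧ ∀ j ∈ S, T j w = 0 := by
  classical
  induction S using Finset.induction_on with
  | empty => exact ⟨v, hv, hp, by simp⟩
  | insert i S _ ih =>
    obtain ⟨w, hw, hwp, hwS⟩ := ih
    obtain ⟨n, hn, hn'⟩ : ∃ n, (T i ^ n) w ≠ 0 ∧ (T i ^ (n + 1)) w = 0 := by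
      by_contra! hne
      exact Nat.rec (by simpa using hw) hne p (hwp i)
    have hcomm {m : ℕ} {j : J} (hj : (T j ^ m) w = 0) : (T j ^ m) ((T i ^ n) w) = 0 := by
      rw [← Module.End.mul_apply, ((hT j i).pow_pow m n).eq, Module.End.mul_apply, hj, map_zero]
    refine ⟨(T i ^ n) w, hn, fun j => hcomm (hwp j), fun j hj => ?_⟩
    obtain rfl | hj := Finset.mem_insert.mp hj
    · rwa [pow_succ', Module.End.mul_apply] at hn'
    · simpa using hcomm (m := 1) (by simpa using hwS j hj)

lemma exists_linearCombination_apply_eq_zero {K V V' J : Type*} [Field K] [AddCommGroup V]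
    [Module K V] [AddCommGroup V'] [Module K V'] [Infinite J] (y : J → V →ₗ[K] V')
    (W : Submodule K V) (U : Submodule K V') [FiniteDimensional K W] [FiniteDimensional K U]
    (h : ∀ j, W ≤ U.comap (y j)) :
    ∃ c : J →₀ K, c ≠ 0 ∧ ∀ w ∈ W, Finsupp.linearCombination K y c w = 0 := by
  have hdep : ¬ LinearIndependent K fun j => (y j).restrict (h j) :=
    fun hind => not_finite_iff_infinite.mpr ‹Infinite J› hind.finite
  rw [linearIndependent_iff] at hdep
  push Not at hdep
  obtain ⟨c, hc, hc0⟩ := hdep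
  refine ⟨c, hc0, fun w hw => ?_⟩
  have hval := congrArg (fun F => (F ⟨w, hw⟩ : V')) hc
  simpa [Finsupp.linearCombination_apply, Finsupp.sum] using hval

end LinearAlgebra

section Weights

variable {I : Type*} {C : Matrix I I ℤ} {d : I → ℕ} {q : ℂ}

lemma k_mul_of_kappaConj_eq_smul {i : I} {Y : LoopAlgebra C d q} {t : ℂ} (ht : t ≠ 0)
    (hY : kappaConj C d q i Y = t⁻¹ • Y) : k C d q i * Y = t • (Y * k C d q i) := by
  calc k C d q i * Y = k C d q i * (t • kappaConj C d q i Y) := by rw [hY, smul_inv_smul₀ ht]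
    _ = t • (Y * k C d q i) := by
      rw [kappaConj_apply, mul_smul_comm, ← mul_assoc, ← mul_assoc, k_mul_kInv, one_mul]

lemma commute_k_phiTilde (i j : I) (m : ℕ) : Commute (k C d q i) (phiTilde C d q j m) :=
  commute_k_of_commute_kInv (commute_kInv_phiTilde i j m)

lemma commute_phiPlus (i j : I) (m m' : ℕ) :
    Commute (phiPlus C d q i m) (phiPlus C d q j m') := by
  rw [phiPlus_eq, phiPlus_eq]
  exact ((commute_k_k i j).mul_right (commute_k_phiTilde i j m')).mul_left
    ((commute_k_phiTilde j i m).symm.mul_right (commute_phiTilde i j m m'))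

lemma phiPlus_zero (i : I) : phiPlus C d q i 0 = k C d q i := by
  rw [phiPlus_eq, phiTilde_zero, mul_one]

lemma IsGenericDatum.phiPlus_add (h : IsGenericDatum C d q) (i : I) (s r : ℕ) :
    phiPlus C d q i (s + 1 + r) = (q ^ d i - (q ^ d i)⁻¹) • (k C d q i *
      ((q ^ d i) ^ (-C i i) • (xPlus C d q i s * xTildeMinus C d q i (r + 1)) -
        xTildeMinus C d q i (r + 1) * xPlus C d q i s)) := by
  rw [smul_xPlus_mul_xTildeMinus_sub i (by omega), mul_smul_comm,
    smul_inv_smul₀ (h.generic_pow i).sub_inv_ne_zero, phiPlus_eq]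
  congr 2
  omega

end Weights

section Rationality

variable {I : Type*} {C : Matrix I I ℤ} {d : I → ℕ} {q : ℂˣ} {l : List I} {j₀ : I}

lemma IsGenericDatum.val_simpleWeight (h : IsGenericDatum C d (q : ℂ)) (i j : I) :
    (simpleWeight C d q i j : ℂ) = ((q : ℂ) ^ d j) ^ C j i := by
  simpa [simpleWeight] using h.pow_zpow_comm i j 1

section Elements

variable (h : IsGenericDatum C d (q : ℂ))
  (hx : ∀ i, xTildeMinus C d (q : ℂ) i 1 ∈ borel C d (q : ℂ) l j₀)

/-- `x⁺_{i,r}`, for `r ≥ 0`, as an element of the Borel algebra. -/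
def xPlusBorel (i : I) (r : ℕ) : borel C d (q : ℂ) l j₀ :=
  ⟨xPlus C d q i r, h.xPlus_mem_borel hx i r⟩

/-- `x̃⁻_{i,r+1}`, for `r ≥ 0`, as an element of the Borel algebra; note the shift of the index. -/
def xTildeMinusBorel (i : I) (r : ℕ) : borel C d (q : ℂ) l j₀ :=
  ⟨xTildeMinus C d q i (r + 1), h.xTildeMinus_mem_borel hx i r⟩

/-- `φ⁺_{i,m}` as an element of the Borel algebra. -/
def phiPlusBorel (i : I) (m : ℕ) : borel C d (q : ℂ) l j₀ :=
  ⟨phiPlus C d q i m, h.phiPlus_mem_borel hx i m⟩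

lemma phiPlusBorel_zero (i : I) : phiPlusBorel h hx i 0 = kBorel C d q l j₀ i :=
  Subtype.ext (phiPlus_zero i)

lemma commute_phiPlusBorel (i j : I) (m m' : ℕ) :
    Commute (phiPlusBorel h hx i m) (phiPlusBorel h hx j m') :=
  Subtype.ext (commute_phiPlus i j m m')

lemma phiPlusBorel_add (i : I) (s r : ℕ) :
    phiPlusBorel h hx i (s + 1 + r) = ((q : ℂ) ^ d i - ((q : ℂ) ^ d i)⁻¹) •
      (kBorel C d q l j₀ i * (((q : ℂ) ^ d i) ^ (-C i i) •
        (xPlusBorel h hx i s * xTildeMinusBorel h hx i r) -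
          xTildeMinusBorel h hx i r * xPlusBorel h hx i s)) :=
  Subtype.ext (h.phiPlus_add i s r)

lemma linearCombination_phiPlusBorel_add (i : I) (s : ℕ) (c : ℕ →₀ ℂ) :
    Finsupp.linearCombination ℂ (fun r => phiPlusBorel h hx i (s + 1 + r)) c =
      ((q : ℂ) ^ d i - ((q : ℂ) ^ d i)⁻¹) • (kBorel C d q l j₀ i * (((q : ℂ) ^ d i) ^ (-C i i) •
        (xPlusBorel h hx i s * Finsupp.linearCombination ℂ (xTildeMinusBorel h hx i) c) -
          Finsupp.linearCombination ℂ (xTildeMinusBorel h hx i) c * xPlusBorel h hx i s)) := by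
  simp only [Finsupp.linearCombination_apply, Finsupp.sum, Finset.mul_sum, Finset.sum_mul,
    Finset.smul_sum, ← Finset.sum_sub_distrib, phiPlusBorel_add]
  refine Finset.sum_congr rfl fun r _ => ?_
  simp only [mul_smul_comm, smul_mul_assoc, mul_sub, smul_sub, smul_comm (c r)]

end Elements

variable {V : Type*} [AddCommGroup V] [Module ℂ V] [Module (borel C d (q : ℂ) l j₀) V]
  [IsScalarTower ℂ (borel C d (q : ℂ) l j₀) V]

lemma smul_mem_weightSpace {ω μ : I → ℂˣ} {x : borel C d (q : ℂ) l j₀}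
    (hx : ∀ j, kappaConj C d q j x = (μ j : ℂ)⁻¹ • (x : LoopAlgebra C d (q : ℂ))) {v : V}
    (hv : v ∈ weightSpace C d q l j₀ V ω) : x • v ∈ weightSpace C d q l j₀ V (ω * μ) := by
  intro j
  have hkx : kBorel C d q l j₀ j * x = (μ j : ℂ) • (x * kBorel C d q l j₀ j) :=
    Subtype.ext (k_mul_of_kappaConj_eq_smul (μ j).ne_zero (hx j))
  calc kBorel C d q l j₀ j • x • v = (μ j : ℂ) • x • kBorel C d q l j₀ j • v := by
        rw [← mul_smul, hkx, smul_assoc, mul_smul]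
    _ = ((ω * μ) j : ℂ) • x • v := by
        rw [hv j, smul_algebra_smul_comm, smul_smul, mul_comm, Pi.mul_apply, Units.val_mul]

variable (h : IsGenericDatum C d (q : ℂ))
  (hx : ∀ i, xTildeMinus C d (q : ℂ) i 1 ∈ borel C d (q : ℂ) l j₀)

lemma xPlusBorel_smul_mem_weightSpace (i : I) (r : ℕ) {ω : I → ℂˣ} {v : V}
    (hv : v ∈ weightSpace C d q l j₀ V ω) :
    xPlusBorel h hx i r • v ∈ weightSpace C d q l j₀ V (ω * simpleWeight C d q i) := by
  refine smul_mem_weightSpace (fun j => ?_) hv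
  rw [h.val_simpleWeight, ← zpow_neg]
  exact kappaConj_xPlus j i r

lemma xTildeMinusBorel_smul_mem_weightSpace (i : I) (r : ℕ) {ω : I → ℂˣ} {v : V}
    (hv : v ∈ weightSpace C d q l j₀ V ω) :
    xTildeMinusBorel h hx i r • v ∈ weightSpace C d q l j₀ V (ω * (simpleWeight C d q i)⁻¹) := by
  refine smul_mem_weightSpace (fun j => ?_) hv
  rw [Pi.inv_apply, Units.val_inv_eq_inv_val, inv_inv, h.val_simpleWeight]
  exact kappaConj_xTildeMinus j i _

theorem exists_linearCombination_phiPlusBorel_smul_eq_zero (ω : I → ℂˣ) (i : I)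
    [FiniteDimensional ℂ (weightSpace C d q l j₀ V ω)]
    [FiniteDimensional ℂ (weightSpace C d q l j₀ V (ω * simpleWeight C d q i))]
    [FiniteDimensional ℂ (weightSpace C d q l j₀ V (ω * (simpleWeight C d q i)⁻¹))] :
    ∃ c : ℕ →₀ ℂ, c ≠ 0 ∧ ∀ s : ℕ, ∀ w ∈ weightSpace C d q l j₀ V ω,
      Finsupp.linearCombination ℂ (fun r => phiPlusBorel h hx i (s + 1 + r)) c • w = 0 := by
  have hmaps (r : ℕ) : weightSpace C d q l j₀ V (ω * simpleWeight C d q i) ⊔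
      weightSpace C d q l j₀ V ω ≤ (weightSpace C d q l j₀ V ω ⊔
        weightSpace C d q l j₀ V (ω * (simpleWeight C d q i)⁻¹)).comap
          (Algebra.lsmul ℂ ℂ V (xTildeMinusBorel h hx i r)) := by
    refine sup_le (fun v hv => Submodule.mem_sup_left ?_) fun v hv => Submodule.mem_sup_right ?_
    · have := xTildeMinusBorel_smul_mem_weightSpace h hx i r hv
      rwa [mul_inv_cancel_right] at this
    · exact xTildeMinusBorel_smul_mem_weightSpace h hx i r hv
  obtain ⟨c, hc, hrel⟩ := exists_linearCombination_apply_eq_zero _ _ _ hmaps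
  have hzero (v : V) (hv : v ∈ weightSpace C d q l j₀ V (ω * simpleWeight C d q i) ⊔
      weightSpace C d q l j₀ V ω) :
      Finsupp.linearCombination ℂ (xTildeMinusBorel h hx i) c • v = 0 := by
    simpa [Finsupp.linearCombination_apply, Finsupp.sum, Finset.sum_smul] using hrel v hv
  refine ⟨c, hc, fun s w hw => ?_⟩
  rw [linearCombination_phiPlusBorel_add, smul_assoc, mul_smul, sub_smul (_ • _),
    smul_assoc, mul_smul, mul_smul, hzero w (Submodule.mem_sup_right hw),
    hzero _ (Submodule.mem_sup_left (xPlusBorel_smul_mem_weightSpace h hx i s hw))]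
  simp only [smul_zero, sub_zero]

theorem exists_mem_weightSpace_phiPlusBorel_smul_eq [Finite I] {Ψ : I → PowerSeries ℂ}
    (hV : lWeightSpace C d q l j₀ V Ψ ≠ ⊥) {ω : I → ℂˣ}
    (hω : ∀ j, PowerSeries.constantCoeff (Ψ j) = (ω j : ℂ)) (S : Finset (I × ℕ)) :
    ∃ w ∈ weightSpace C d q l j₀ V ω, w ≠ 0 ∧ ∀ t ∈ S,
      phiPlusBorel h hx t.1 t.2 • w = PowerSeries.coeff t.2 (Ψ t.1) • w := by
  classical
  have := Fintype.ofFinite I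
  obtain ⟨v, ⟨p, hp⟩, hv⟩ := (Submodule.ne_bot_iff _).mp hV
  let T (t : I × ℕ) : borel C d (q : ℂ) l j₀ :=
    phiPlusBorel h hx t.1 t.2 - algebraMap ℂ _ (PowerSeries.coeff t.2 (Ψ t.1))
  have hT (t t' : I × ℕ) : Commute (T t) (T t') :=
    ((commute_phiPlusBorel h hx t.1 t'.1 t.2 t'.2).sub_left
      (Algebra.commute_algebraMap_left _ _)).sub_right (Algebra.commute_algebraMap_right _ _)
  obtain ⟨w, hw0, -, hw⟩ := exists_ne_zero_forall_apply_eq_zero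
    (T := fun t => Algebra.lsmul ℂ ℂ V (T t)) (fun t t' => (hT t t').map _) hv
    (fun t => by rw [← map_pow]; exact hp t.1 t.2 _ rfl)
    (Finset.univ.image (fun j => (j, 0)) ∪ S)
  have heig (t : I × ℕ) (ht : t ∈ Finset.univ.image (fun j => (j, 0)) ∪ S) :
      phiPlusBorel h hx t.1 t.2 • w = PowerSeries.coeff t.2 (Ψ t.1) • w := by
    have hTw : T t • w = 0 := hw t ht
    rwa [sub_smul, algebraMap_smul, sub_eq_zero] at hTw
  refine ⟨w, fun j => ?_, hw0, fun t ht => heig t (Finset.mem_union_right _ ht)⟩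
  simpa [phiPlusBorel_zero, hω] using heig (j, 0) (by simp)

include h hx in
theorem isRational_of_finiteDimensional [Finite I] {Ψ : I → PowerSeries ℂ}
    (hV : lWeightSpace C d q l j₀ V Ψ ≠ ⊥) {ω : I → ℂˣ}
    (hω : ∀ j, PowerSeries.constantCoeff (Ψ j) = (ω j : ℂ)) (i : I)
    [FiniteDimensional ℂ (weightSpace C d q l j₀ V ω)]
    [FiniteDimensional ℂ (weightSpace C d q l j₀ V (ω * simpleWeight C d q i))]
    [FiniteDimensional ℂ (weightSpace C d q l j₀ V (ω * (simpleWeight C d q i)⁻¹))] :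
    IsRational (Ψ i) := by
  classical
  obtain ⟨c, hc, hrel⟩ := exists_linearCombination_phiPlusBorel_smul_eq_zero (V := V) h hx ω i
  refine isRational_of_recurrence hc (N := 1) fun s hs => ?_
  obtain ⟨s, rfl⟩ := Nat.exists_eq_add_of_le' hs
  obtain ⟨w, hwω, hw0, hw⟩ := exists_mem_weightSpace_phiPlusBorel_smul_eq h hx hV hω
    (c.support.image fun r => (i, s + 1 + r))
  refine (smul_eq_zero.mp ?_).resolve_right hw0
  calc (c.sum fun r a => a * PowerSeries.coeff (s + 1 + r) (Ψ i)) • w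
      = Finsupp.linearCombination ℂ (fun r => phiPlusBorel h hx i (s + 1 + r)) c • w := by
        rw [Finsupp.linearCombination_apply, Finsupp.sum, Finsupp.sum, Finset.sum_smul,
          Finset.sum_smul]
        refine Finset.sum_congr rfl fun r hr => ?_
        rw [smul_assoc, hw _ (Finset.mem_image_of_mem _ hr), smul_smul]
    _ = 0 := hrel s w hwω

end Rationality

end

end QuantumLoop

open QuantumLoop in
theorem proposition3p3 {ι M N : Type*} [Finite ι]
    [AddCommGroup M] [Module ℂ M] [AddCommGroup N] [Module ℂ N]
    (P : RootPairing ι ℂ M N) [P.IsRootSystem] [P.IsCrystallographic] [P.IsReduced]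
    [P.IsIrreducible] (b : P.Base)
    (d : b.support → ℕ) (hd : IsSymmetrizer b.cartanMatrix.transpose d)
    (q : ℂˣ) (hq : ∀ n : ℕ, 0 < n → q ^ n ≠ 1)
    (l : List b.support) (j₀ : b.support) (hl : IsMaximalRootWord b l j₀)
    (V : Type*) [AddCommGroup V] [Module ℂ V]
    [Module (borel b.cartanMatrix.transpose d (q : ℂ) l j₀) V]
    [IsScalarTower ℂ (borel b.cartanMatrix.transpose d (q : ℂ) l j₀) V]
    (Ψ : b.support → PowerSeries ℂ) (hΨ : IsLWeight Ψ)
    (hV : lWeightSpace b.cartanMatrix.transpose d q l j₀ V Ψ ≠ ⊥) :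
    (∀ (ω : b.support → ℂˣ) (i : b.support),
      (∀ j, PowerSeries.constantCoeff (Ψ j) = (ω j : ℂ)) →
      FiniteDimensional ℂ (weightSpace b.cartanMatrix.transpose d q l j₀ V ω) →
      FiniteDimensional ℂ (weightSpace b.cartanMatrix.transpose d q l j₀ V
        (ω * simpleWeight b.cartanMatrix.transpose d q i)) →
      FiniteDimensional ℂ (weightSpace b.cartanMatrix.transpose d q l j₀ V
        (ω * (simpleWeight b.cartanMatrix.transpose d q i)⁻¹)) →
      IsRational (Ψ i)) ∧
    (InCategoryO b.cartanMatrix.transpose d q l j₀ V → ∀ i, IsRational (Ψ i)) := by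
  have h := isGenericDatum_cartanMatrix b hd hq
  have hx := hl.xTildeMinus_one_mem_borel h
  refine ⟨fun ω i hω _ _ _ => isRational_of_finiteDimensional h hx hV hω i, fun hO i => ?_⟩
  have := hO.finite
  exact isRational_of_finiteDimensional h hx hV (ω := fun j => Units.mk0 _ (hΨ j)) (fun j => rfl) i
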